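/- A model of ACVF is an algebraically closed field with a non-trivial valuation $v$ (written additively), regarded as a first-order structure in the language of rings together with a binary relation $x\mid y$ interpreted as $v(x)\le v(y)$. For structures $M\subseteq N$ in a common language and $n\ge 1$, $T_n(M,N)$ means that for every $a\in N^n$ the type $\mathrm{tp}(a/M)$ is definable: for every formula $\varphi(x,y)$ without parameters, $x$ an $n$-tuple and $y$ a finite tuple of variables, there is a formula $\delta(y)$ with parameters in $M$ such that for all tuples $b$ from $M$, $N\models\varphi(a,b)$ if and only if $M\models\delta(b)$. Theorem 1.7. Let $(K\prec L,v)$ be two models of ACVF, with value groups $vK\subseteq vL$, which are regarded as structures in the language $(+,-,0,\le)$ of ordered abelian groups. The following are equivalent: 1. $T_n(K,L)$ holds for all $n\ge 1$; 2. the extension $(K\subseteq L,v)$ is separated, i.e. every finitely generated $K$-vector subspace of $L$ has a $K$-basis $y_1,\dots,y_m$ such that $v\left(\sum_{i=1}^m k_iy_i\right)=\min_{1\le i\le m} v(k_iy_i)$ for all $k_1,\dots,k_m\in K$ (the empty minimum being $\infty$); and $T_1(vK,vL)$ holds. -/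

import Mathlib

namespace DefinableTypes

open FirstOrder FirstOrder.Language

/-! ### Types over a structure and their definability -/

section Types

variable {𝓛 : Language} {M N : Type*} [𝓛.Structure M] [𝓛.Structure N]

/-- The map `f : M → N` is an elementary embedding, so that `M ≺ N` along `f`. -/
def IsElementary (𝓛 : Language) {M N : Type*} [𝓛.Structure M] [𝓛.Structure N]
    (f : M → N) : Prop :=
  ∃ g : M ↪ₑ[𝓛] N, ∀ x, g x = f x

/-- The type `tp(a/M)` of the tuple `a ∈ Nⁿ`, where `M` is seen inside `N` along `f`: all formulas
`φ(x₁, …, xₙ)` with parameters in `M` (a free variable `Sum.inr m` is the parameter `m`) that hold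
of `a` in `N`. -/
def tp (𝓛 : Language) {M N : Type*} [𝓛.Structure N] (f : M → N) {n : ℕ} (a : Fin n → N) :
    Set (𝓛.Formula (Fin n ⊕ M)) :=
  {φ | φ.Realize (Sum.elim a f)}

/-- A type `p(x)` over `M` is definable if for every formula `φ(x, y)` without parameters there is
a formula `δ(y)` with parameters in `M` such that, for all tuples `b` of `M`,
`φ(x, b) ∈ p` if and only if `M ⊨ δ(b)`. -/
def IsDefinableType {n : ℕ} (p : Set (𝓛.Formula (Fin n ⊕ M))) : Prop :=
  ∀ (m : ℕ) (φ : 𝓛.Formula (Fin n ⊕ Fin m)),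
    ∃ δ : 𝓛[[M]].Formula (Fin m), ∀ b : Fin m → M,
      φ.relabel (Sum.map id b) ∈ p ↔ δ.Realize b

/-- `T_n(M, N)`: for every `a ∈ Nⁿ` the type `tp(a/M)` is definable. -/
def TypesDefinable (𝓛 : Language) {M N : Type*} [𝓛.Structure M] [𝓛.Structure N]
    (n : ℕ) (f : M → N) : Prop :=
  ∀ a : Fin n → N, IsDefinableType (tp 𝓛 f a)

end Types

/-! ### The language of valued fields -/

/-- The divisibility symbol. -/
inductive DivRel : ℕ → Type
  | div : DivRel 2

/-- The language of rings together with a binary relation symbol for divisibility. -/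
def valuedFieldLang : Language := ⟨ringFunc, DivRel⟩

/-! ### The language of ordered abelian groups -/

/-- The function symbols of ordered abelian groups. -/
inductive OAGFunc : ℕ → Type
  | add : OAGFunc 2
  | neg : OAGFunc 1
  | zero : OAGFunc 0

/-- The order symbol. -/
inductive OAGRel : ℕ → Type
  | le : OAGRel 2

/-- The language `(+, -, 0, ≤)` of ordered abelian groups. -/
def orderedGroupLang : Language := ⟨OAGFunc, OAGRel⟩

/-- An ordered abelian group as a first-order structure. -/
instance orderedGroupStructure (G : Type*) [AddCommGroup G] [LinearOrder G] :
    orderedGroupLang.Structure G where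
  funMap := fun {n} f =>
    match n, f with
    | _, .add => fun x => x 0 + x 1
    | _, .neg => fun x => -x 0
    | _, .zero => fun _ => 0
  RelMap := fun {n} r =>
    match n, r with
    | _, .le => fun x => x 0 ≤ x 1

/-! ### Valued fields, written additively: `v : F → Γ ∪ {∞}` -/

section Valued

variable {Γ : Type*} [AddCommGroup Γ] [LinearOrder Γ] [IsOrderedAddMonoid Γ]

/-- A valued field as a first-order structure, where `x ∣ y` means `v x ≤ v y`. -/
@[reducible]
def valuedFieldStructure {F : Type*} [Field F] (v : AddValuation F (WithTop Γ)) :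
    valuedFieldLang.Structure F where
  funMap := fun {n} f =>
    match n, f with
    | _, .add => fun x => x 0 + x 1
    | _, .mul => fun x => x 0 * x 1
    | _, .neg => fun x => -x 0
    | _, .zero => fun _ => 0
    | _, .one => fun _ => 1
  RelMap := fun {n} r =>
    match n, r with
    | _, .div => fun x => v (x 0) ≤ v (x 1)

/-- Models of ACVF: algebraically closed fields with a non-trivial valuation. -/
structure IsModelACVF {F : Type*} [Field F] (v : AddValuation F (WithTop Γ)) : Prop where
  isAlgClosed : IsAlgClosed F
  nontrivial : ∃ x : F, x ≠ 0 ∧ v x ≠ 0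

/-- The value group `vF = v(F ∖ {0})`. -/
def valueGroup {F : Type*} [Field F] (v : AddValuation F (WithTop Γ)) : AddSubgroup Γ where
  carrier := {γ | ∃ x : F, v x = (γ : WithTop Γ)}
  add_mem' := by
    rintro a b ⟨x, hx⟩ ⟨y, hy⟩
    exact ⟨x * y, by rw [v.map_mul, hx, hy, WithTop.coe_add]⟩
  zero_mem' := ⟨1, by rw [v.map_one, WithTop.coe_zero]⟩
  neg_mem' := by
    rintro a ⟨x, hx⟩
    have hx0 : x ≠ 0 := by
      rintro rfl
      rw [v.map_zero] at hx
      exact WithTop.top_ne_coe hx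
    refine ⟨x⁻¹, ?_⟩
    have h : v x⁻¹ + v x = 0 := by rw [← v.map_mul, inv_mul_cancel₀ hx0, v.map_one]
    rw [hx] at h
    cases hy : v x⁻¹ with
    | top => rw [hy] at h; simp at h
    | coe c =>
      rw [hy, ← WithTop.coe_add, ← WithTop.coe_zero, WithTop.coe_inj] at h
      rw [eq_neg_of_add_eq_zero_left h]

variable {L : Type*} [Field L] (v : AddValuation L (WithTop Γ)) (K : Subfield L)

/-- The restriction to the subfield `K` of a valuation on `L`. -/
abbrev restrictVal : AddValuation K (WithTop Γ) := v.comap K.subtype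

theorem valueGroup_restrictVal_le : valueGroup (restrictVal v K) ≤ valueGroup v := by
  rintro γ ⟨x, hx⟩
  exact ⟨x, hx⟩

/-- `(K, v) ≺ (L, v)` in the language of valued fields. -/
def IsElementaryExtension : Prop :=
  letI := valuedFieldStructure (restrictVal v K)
  letI := valuedFieldStructure v
  IsElementary valuedFieldLang (Subtype.val : K → L)

/-- `T_n(K, L)` for the valued fields `K ⊆ L`. -/
def FieldTypesDefinable (n : ℕ) : Prop :=
  letI := valuedFieldStructure (restrictVal v K)
  letI := valuedFieldStructure v
  TypesDefinable valuedFieldLang n (Subtype.val : K → L)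

/-- `T_n(vK, vL)` for the ordered abelian groups `vK ⊆ vL`. -/
def ValueGroupTypesDefinable (n : ℕ) : Prop :=
  TypesDefinable orderedGroupLang n (AddSubgroup.inclusion (valueGroup_restrictVal_le v K))

/-- The sequence `y` is separated over `K`: `v(∑ kᵢ yᵢ) = minᵢ v(kᵢ yᵢ)` for all `kᵢ ∈ K`
(the empty minimum being `∞`). -/
def IsSeparatedSeq {m : ℕ} (y : Fin m → L) : Prop :=
  ∀ k : Fin m → K,
    v (∑ i, (k i : L) * y i) = Finset.univ.inf fun i => v ((k i : L) * y i)

/-- The extension `K ⊆ L` is separated: every finitely generated `K`-vector subspace of `L` has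
a separated basis. -/
def IsSeparatedExtension : Prop :=
  ∀ V : Submodule K L, V.FG →
    ∃ (m : ℕ) (b : Module.Basis (Fin m) K V), IsSeparatedSeq v K fun i => (b i : L)

end Valued

end DefinableTypes

/-! Both conditions are compared with one property, `TraceDefinable`: the trace on powers of `K` of
a quantifier free set over `L` (a Boolean combination of divisibilities between polynomials) is
quantifier free over `K`. Quantifier elimination in `K` and in `L` makes it equivalent to
definability of all types.

Suppose the extension is separated and `T_1(vK, vL)` holds. Expanding the coefficients of `P` and
`Q` in a separated basis `e` of their `K`-span gives `P(b) = ∑ pᵢ(b) eᵢ` and `Q(b) = ∑ qⱼ(b) eⱼ` for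
`b` in `K`. Hence `v(P(b)) ≤ v(Q(b))` says that for every `j` some `i` has `v(pᵢ(b) eᵢ) ≤ v(qⱼ(b)
eⱼ)`. For nonzero coordinates this places `v(pᵢ(b)/qⱼ(b))` below `v(eⱼ/eᵢ)`, and the cut of that
value in `vK` is definable (`traceDefinable_of_separated`).

Conversely, suppose traces are definable. The value group is interpreted in the field, so a formula
over `vL` restricts to a quantifier free condition on `K`. It becomes a formula over `vK` because
values lift to generic tuples, at which finitely many given polynomials take the minimum of the
values of their monomials (`exists_generic_lift`). Separated bases are built as in Gram-Schmidt, by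
subtracting a best approximation of the new vector in the span of the previous ones. If there were
none, some coordinate would carry a definable nest of balls of `K` with empty intersection.
`QF.nest_false` excludes this: far along the nest the relevant polynomial coefficients have constant
value, so the defining formula cannot detect that the radii still shrink.

Quantifier elimination itself (`QF.projection`) is proved with ultrapowers. If a projection is not
quantifier free, two ultrafilters with the same quantifier free sets disagree on it, and
`exists_same_pattern` carries a witness from one ultrapower to the other. That transfer rests on the
conjugacy of valuation rings in a normal extension (`exists_eq_comap`) and on generic points at a
given distance from the nearest root. -/

namespace DefinableTypes

/-! ### Conjugacy of valuation rings in a finite normal extension -/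

section Conjugacy

open Polynomial

variable {A N : Type*} [Field A] [Field N] [Algebra A N]

/-- The image in `N` of the trace on `A` of a valuation ring of `N`. -/
def traceSet (A : Type*) {N : Type*} [Field A] [Field N] [Algebra A N] (O : ValuationSubring N) :
    Set N :=
  {x | x ∈ O ∧ x ∈ Set.range (algebraMap A N)}

/-- Divide an equation of `x` over `A` by its last coefficient of maximal valuation, of index `j`,
and split it at `j`. The upper part is `x ^ j * y` with `y` equal to 1 plus terms of valuation below
1. The lower part shows that `z = x * y` is a polynomial in `x⁻¹`. In a valuation ring containing
the coefficients, use `y` if it contains `x`, and `z` if it contains `x⁻¹`. -/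
theorem exists_quotient_of_mem (O : ValuationSubring N) {x : N} (hx : x ∈ O)
    (hx0 : x ≠ 0) (halg : IsAlgebraic A x) :
    ∃ y z : N, x * y = z ∧ O.valuation y = 1 ∧
      ∀ V : ValuationSubring N, traceSet A O ⊆ V → y ∈ V ∧ z ∈ V := by
  obtain ⟨p, hp0, hp⟩ := halg
  set f : ℕ → N := fun i => algebraMap A N (p.coeff i) with hf
  -- the last coefficient of maximal valuation
  obtain ⟨j, hj, hjmax⟩ : ∃ j ∈ p.support, ∀ i ∈ p.support,
      toLex (O.valuation (f i), i) ≤ toLex (O.valuation (f j), j) :=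
    Finset.exists_max_image p.support (fun i => toLex (O.valuation (f i), i))
      (Polynomial.support_nonempty.2 hp0)
  have hfj : f j ≠ 0 := by
    simp only [hf, ne_eq, map_eq_zero]
    exact Polynomial.mem_support_iff.1 hj
  have hle : ∀ i, O.valuation (f i) ≤ O.valuation (f j) := by
    intro i
    by_cases hi : i ∈ p.support
    · rcases Prod.Lex.le_iff.1 (hjmax i hi) with h | h
      · exact h.le
      · exact h.1.le
    · simp [hf, Polynomial.notMem_support_iff.1 hi]
  have hlt : ∀ i, j < i → O.valuation (f i) < O.valuation (f j) := by
    intro i hij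
    by_cases hi : i ∈ p.support
    · rcases Prod.Lex.le_iff.1 (hjmax i hi) with h | h
      · exact h
      · exact absurd h.2 (not_le.2 hij)
    · have h0 : f i = 0 := by simp [hf, Polynomial.notMem_support_iff.1 hi]
      rw [h0, map_zero]
      exact zero_lt_iff.2 ((Valuation.ne_zero_iff _).2 hfj)
  set g : ℕ → N := fun i => f i / f j with hg
  have hvj : O.valuation (f j) ≠ 0 := (Valuation.ne_zero_iff _).2 hfj
  have hgle : ∀ i, O.valuation (g i) ≤ 1 := fun i => by
    rw [hg, map_div₀]
    exact div_le_one_of_le₀ (hle i) zero_le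
  have hglt : ∀ i, j < i → O.valuation (g i) < 1 := fun i hi => by
    rw [hg, map_div₀]
    exact (div_lt_one₀ (zero_lt_iff.2 hvj)).2 (hlt i hi)
  have hgj : g j = 1 := div_self hfj
  have hgs : ∀ i, g i ∈ traceSet A O := fun i =>
    ⟨(O.valuation_le_one_iff _).1 (hgle i), p.coeff i / p.coeff j, by simp [hg, hf]⟩
  have hjd : j ≤ p.natDegree := Polynomial.le_natDegree_of_mem_supp _ hj
  set m := p.natDegree - j with hm
  set y : N := ∑ i ∈ Finset.range (m + 1), g (j + i) * x ^ i with hy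
  set z : N := -∑ i ∈ Finset.range j, g i * x⁻¹ ^ (j - 1 - i) with hz
  have hsum : ∑ i ∈ Finset.range (j + (m + 1)), g i * x ^ i = 0 := by
    have h1 : aeval x p = ∑ i ∈ Finset.range (p.natDegree + 1), f i * x ^ i := by
      rw [Polynomial.aeval_eq_sum_range]
      exact Finset.sum_congr rfl fun i _ => by rw [Algebra.smul_def]
    rw [hp] at h1
    have h2 : j + (m + 1) = p.natDegree + 1 := by omega
    rw [h2]
    have h3 : ∑ i ∈ Finset.range (p.natDegree + 1), g i * x ^ i =
        (∑ i ∈ Finset.range (p.natDegree + 1), f i * x ^ i) / f j := by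
      rw [Finset.sum_div]
      exact Finset.sum_congr rfl fun i _ => by simp only [hg]; ring
    rw [h3, ← h1, zero_div]
  have hxy : x * y = z := by
    rw [Finset.sum_range_add] at hsum
    have h1 : ∑ i ∈ Finset.range (m + 1), g (j + i) * x ^ (j + i) = x ^ j * y := by
      rw [hy, Finset.mul_sum]
      exact Finset.sum_congr rfl fun i _ => by rw [pow_add]; ring
    have h2 : x * ∑ i ∈ Finset.range j, g i * x ^ i = - (x ^ j * z) := by
      rw [hz, Finset.mul_sum, mul_neg, neg_neg, Finset.mul_sum]
      refine Finset.sum_congr rfl fun i hi => ?_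
      have hij : i < j := Finset.mem_range.1 hi
      have h4 : x ^ j = x ^ (j - 1 - i) * (x ^ i * x) := by
        rw [← pow_succ, ← pow_add]; congr 1; omega
      rw [h4, inv_pow]
      field_simp
    rw [h1] at hsum
    have h3 : x ^ j * (x * y) = x ^ j * z := by
      have := congrArg (fun t => x * t) hsum
      simp only [mul_add, mul_zero, h2] at this
      linear_combination this
    exact mul_left_cancel₀ (pow_ne_zero j hx0) h3
  have hxO : O.valuation x ≤ 1 := (O.valuation_le_one_iff _).2 hx
  refine ⟨y, z, hxy, ?_, fun V hV => ?_⟩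
  · rw [hy, Finset.sum_range_succ', add_zero, pow_zero, mul_one, hgj]
    refine Valuation.map_one_add_of_lt _ (Valuation.map_sum_lt' _ zero_lt_one fun i _ => ?_) |> fun h => by
      rw [add_comm]; exact h
    rw [map_mul, map_pow]
    exact mul_lt_one_of_lt_of_le (hglt _ (by omega)) (pow_le_one' hxO _)
  · have hgV : ∀ i, g i ∈ V := fun i => hV (hgs i)
    rcases V.mem_or_inv_mem x with h | h
    · have hyV : y ∈ V := sum_mem fun i _ => mul_mem (hgV _) (pow_mem h _)
      exact ⟨hyV, hxy ▸ mul_mem h hyV⟩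
    · have hzV : z ∈ V := neg_mem (sum_mem fun i _ => mul_mem (hgV _) (pow_mem h _))
      refine ⟨?_, hzV⟩
      have : y = x⁻¹ * z := by rw [← hxy]; field_simp
      rw [this]
      exact mul_mem h hzV

/-- All roots of the minimal polynomial are conjugate to `x`, hence equal to `x`, and its constant
term is `x ^ d` up to sign. A power is needed because the extension may be inseparable. -/
theorem exists_pow_eq_algebraMap_of_fixed [Normal A N] {x : N}
    (hx : ∀ σ : N ≃ₐ[A] N, σ x = x) : ∃ d : ℕ, d ≠ 0 ∧ ∃ a : A, x ^ d = algebraMap A N a := by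
  have hint : IsIntegral A x := Normal.isIntegral ‹_› x
  have hspl := Normal.splits (F := A) (K := N) ‹_› x
  have hroots : ∀ y ∈ ((minpoly A x).map (algebraMap A N)).roots, y = x := by
    intro y hy
    obtain ⟨σ, hσ⟩ := minpoly.exists_algEquiv_of_root (K := A) (x := y) (y := x)
      hint.isAlgebraic (by
        have h0 := (Polynomial.mem_roots'.1 hy).2
        rwa [Polynomial.IsRoot.def, Polynomial.eval_map_algebraMap] at h0)
    rw [← hx σ⁻¹, ← hσ]
    exact (σ.symm_apply_apply y).symm
  have hmon := (minpoly.monic hint).map (algebraMap A N)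
  have hcard := hspl.natDegree_eq_card_roots
  refine ⟨(minpoly A x).natDegree, (minpoly.natDegree_pos hint).ne',
    (-1) ^ (minpoly A x).natDegree * (minpoly A x).coeff 0, ?_⟩
  have h0 := hspl.coeff_zero_eq_prod_roots_of_monic hmon
  rw [Multiset.eq_replicate_card.2 hroots, Multiset.prod_replicate, ← hcard,
    Polynomial.natDegree_map, Polynomial.coeff_map] at h0
  rw [map_mul, h0, map_pow, map_neg, map_one, ← mul_assoc, ← mul_pow]
  simp

variable (A) in
/-- The integral closure in `N` of the trace on `A` of a valuation ring. -/
def traceClosure (O : ValuationSubring N) : Subring N :=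
  (integralClosure (Subring.closure (traceSet A O)) N).toSubring

theorem mem_traceClosure {O : ValuationSubring N} {x : N} :
    x ∈ traceClosure A O ↔ ∀ V : ValuationSubring N, traceSet A O ⊆ V → x ∈ V := by
  rw [traceClosure, ← iInf_valuationSubring_superset, Subring.mem_iInf]
  exact ⟨fun h V hV => h ⟨V, hV⟩, fun h V => h V.1 V.2⟩

theorem traceSet_comap (O : ValuationSubring N) (σ : N ≃ₐ[A] N) :
    traceSet A (O.comap (σ : N →+* N)) = traceSet A O := by
  ext x
  constructor
  · rintro ⟨h, a, rfl⟩
    refine ⟨?_, a, rfl⟩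
    simpa using h
  · rintro ⟨h, a, rfl⟩
    refine ⟨?_, a, rfl⟩
    simpa using h

/-- Prime avoidance in the integral closure of the common trace: the center `I` of `O₂` is covered
by the finitely many centers `f σ` of the conjugates of `O₁`, so it lies in one of them. -/
theorem exists_comap_le [FiniteDimensional A N] [Normal A N] (O₁ O₂ : ValuationSubring N)
    (h : traceSet A O₁ = traceSet A O₂) :
    ∃ σ : N ≃ₐ[A] N, O₁.comap (σ : N →+* N) ≤ O₂ := by
  classical
  have hC₁ : ∀ c : traceClosure A O₁, ∀ σ : N ≃ₐ[A] N, O₁.valuation (σ c) ≤ 1 := fun c σ =>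
    (O₁.valuation_le_one_iff _).2 (mem_traceClosure.1 c.2 (O₁.comap (σ : N →+* N)) (by
      rw [← traceSet_comap O₁ σ]; exact fun x hx => hx.1))
  have hC₂ : ∀ c : traceClosure A O₁, ∀ σ : N ≃ₐ[A] N, O₂.valuation (σ c) ≤ 1 := fun c σ =>
    (O₂.valuation_le_one_iff _).2 (mem_traceClosure.1 c.2 (O₂.comap (σ : N →+* N)) (by
      rw [h, ← traceSet_comap O₂ σ]; exact fun x hx => hx.1))
  have hA : ∀ a : A, O₂.valuation (algebraMap A N a) < 1 → O₁.valuation (algebraMap A N a) < 1 := by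
    intro a ha
    rw [← ValuationSubring.mem_nonunits_iff, ValuationSubring.mem_nonunits_iff_or] at ha ⊢
    refine ha.imp_right fun ha' hmem => ha' ?_
    have : (algebraMap A N a)⁻¹ ∈ traceSet A O₁ := ⟨hmem, a⁻¹, by simp⟩
    rw [h] at this
    exact this.1
  let f : (N ≃ₐ[A] N) → Ideal (traceClosure A O₁) := fun σ =>
    { carrier := {c | O₁.valuation (σ c) < 1}
      add_mem' := fun {a b} ha hb => by
        simp only [Set.mem_ofPred_eq, Subring.coe_add, map_add] at *
        exact Valuation.map_add_lt _ ha hb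
      zero_mem' := by simp
      smul_mem' := fun c x hx => by
        simp only [Set.mem_ofPred_eq, smul_eq_mul, Subring.coe_mul, map_mul] at *
        rw [mul_comm]
        exact mul_lt_one_of_lt_of_le hx (hC₁ c σ) }
  let I : Ideal (traceClosure A O₁) :=
    { carrier := {c | O₂.valuation c < 1}
      add_mem' := fun {a b} ha hb => by
        simp only [Set.mem_ofPred_eq, Subring.coe_add] at *
        exact Valuation.map_add_lt _ ha hb
      zero_mem' := by simp
      smul_mem' := fun c x hx => by
        simp only [Set.mem_ofPred_eq, smul_eq_mul, Subring.coe_mul, map_mul] at *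
        rw [mul_comm]
        exact mul_lt_one_of_lt_of_le hx (hC₂ c 1) }
  have hprime : ∀ σ, (f σ).IsPrime := by
    intro σ
    refine ⟨fun htop => ?_, fun {x y} hxy => ?_⟩
    · have : (1 : traceClosure A O₁) ∈ f σ := htop ▸ Submodule.mem_top
      have h1 : O₁.valuation (σ ((1 : traceClosure A O₁) : N)) < 1 := this
      simp at h1
    · have h1 : O₁.valuation (σ ((x * y : traceClosure A O₁) : N)) < 1 := hxy
      by_contra hcon
      push Not at hcon
      have hx : 1 ≤ O₁.valuation (σ x) := not_lt.1 hcon.1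
      have hy : 1 ≤ O₁.valuation (σ y) := not_lt.1 hcon.2
      rw [Subring.coe_mul, map_mul, map_mul] at h1
      exact absurd h1 (not_lt.2 (one_le_mul_of_one_le_of_one_le hx hy))
  -- The product of the conjugates of `c` has a power in `A`, where the two maximal ideals can be
  -- compared. So some conjugate of `c` is a nonunit of `O₁`.
  have hcover : (I : Set (traceClosure A O₁)) ⊆ ⋃ σ ∈ ((Finset.univ : Finset (N ≃ₐ[A] N)) : Set _),
      (f σ : Set (traceClosure A O₁)) := by
    intro c hc
    have hc : O₂.valuation c < 1 := hc
    set n : N := ∏ σ : N ≃ₐ[A] N, σ c with hn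
    have hfix : ∀ τ : N ≃ₐ[A] N, τ n = n := by
      intro τ
      rw [hn, map_prod]
      exact Fintype.prod_equiv (Equiv.mulLeft τ) _ _ fun σ => rfl
    obtain ⟨d, hd, a, ha⟩ := exists_pow_eq_algebraMap_of_fixed hfix
    have hn2 : O₂.valuation n < 1 := by
      rw [hn, ← Finset.mul_prod_erase _ _ (Finset.mem_univ (1 : N ≃ₐ[A] N)), map_mul, map_prod]
      exact mul_lt_one_of_lt_of_le hc (Finset.prod_le_one' fun σ _ => hC₂ c σ)
    have hn1 : O₁.valuation (n ^ d) < 1 := by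
      rw [ha]
      refine hA a ?_
      rw [← ha, map_pow]
      exact pow_lt_one' hn2 hd
    by_contra hcon
    simp only [Finset.coe_univ, Set.mem_univ, Set.iUnion_true, Set.mem_iUnion, not_exists] at hcon
    have h1 : ∀ σ : N ≃ₐ[A] N, O₁.valuation (σ c) = 1 := fun σ =>
      le_antisymm (hC₁ c σ) (not_lt.1 (hcon σ))
    rw [map_pow, hn, map_prod, Finset.prod_congr rfl fun σ _ => h1 σ] at hn1
    simp at hn1
  obtain ⟨σ, -, hσ⟩ := (Ideal.subset_union_prime 1 1 fun σ _ _ _ => hprime σ).1 hcover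
  refine ⟨σ, fun x hx => ?_⟩
  by_cases hx0 : x = 0
  · rw [hx0]; exact zero_mem O₂
  -- Write `x = z / y` with `y` and `z` in the integral closure and `y` outside `f σ`. Then `y` is
  -- outside `I`, that is, a unit of `O₂`.
  obtain ⟨y, z, hxy, hy, hV⟩ := exists_quotient_of_mem (A := A) (O₁.comap (σ : N →+* N)) hx hx0
    (Algebra.IsAlgebraic.isAlgebraic x)
  rw [traceSet_comap] at hV
  have hyC : y ∈ traceClosure A O₁ := mem_traceClosure.2 fun V h => (hV V h).1
  have hzC : z ∈ traceClosure A O₁ := mem_traceClosure.2 fun V h => (hV V h).2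
  have hy1 : ¬ O₁.valuation (σ y) < 1 := by
    intro hlt
    have hy0 : y ≠ 0 := by rintro rfl; simp at hy
    have h1 : y⁻¹ ∈ O₁.comap (σ : N →+* N) := by
      rw [← ValuationSubring.valuation_le_one_iff, map_inv₀, hy, inv_one]
    rw [← ValuationSubring.mem_nonunits_iff, ValuationSubring.mem_nonunits_iff_or] at hlt
    rcases hlt with h2 | h2
    · exact hy0 (by simpa using h2)
    · apply h2
      have : (σ : N →+* N) y⁻¹ ∈ O₁ := h1
      simpa using this
  have hy2 : O₂.valuation y = 1 := by
    refine le_antisymm (hC₂ ⟨y, hyC⟩ 1) (not_lt.1 fun hlt => hy1 ?_)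
    exact hσ (show (⟨y, hyC⟩ : traceClosure A O₁) ∈ I from hlt)
  have hz2 : O₂.valuation z ≤ 1 := hC₂ ⟨z, hzC⟩ 1
  rw [← ValuationSubring.valuation_le_one_iff]
  rwa [← hxy, map_mul, hy2, mul_one] at hz2

/-- Valuation rings of a finite normal extension with the same trace are conjugate. -/
theorem exists_eq_comap [FiniteDimensional A N] [Normal A N] (O₁ O₂ : ValuationSubring N)
    (h : traceSet A O₁ = traceSet A O₂) :
    ∃ σ : N ≃ₐ[A] N, O₁.comap (σ : N →+* N) = O₂ := by
  obtain ⟨σ, hσ⟩ := exists_comap_le O₁ O₂ h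
  obtain ⟨τ, hτ⟩ := exists_comap_le O₂ O₁ h.symm
  refine ⟨σ, le_antisymm hσ ?_⟩
  -- The automorphism `τ * σ` has finite order, so iterating one inclusion around its cycle gives
  -- the reverse inclusion.
  have hστ : ∀ x, (τ * σ) x ∈ O₂ → σ x ∈ O₁ := fun x hx => hτ hx
  have hρ : ∀ x, (τ * σ) x ∈ O₂ → x ∈ O₂ := fun x hx => hσ (hστ x hx)
  have hiter : ∀ k x, ((τ * σ) ^ k) x ∈ O₂ → x ∈ O₂ := by
    intro k
    induction k with
    | zero => intro x hx; simpa using hx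
    | succ k ih =>
      intro x hx
      rw [pow_succ'] at hx
      exact ih x (hρ _ hx)
  intro x hx
  refine hστ x ?_
  obtain ⟨k, hk, hk1⟩ := (isOfFinOrder_of_finite (τ * σ)).exists_pow_eq_one
  refine hiter (k - 1) _ ?_
  have : ((τ * σ) ^ (k - 1)) ((τ * σ) x) = ((τ * σ) ^ (k - 1) * (τ * σ)) x := rfl
  rw [this, ← pow_succ, Nat.sub_add_cancel hk, hk1]
  exact hx

end Conjugacy

end DefinableTypes

/-! ### Polynomials in one variable over algebraically closed valued fields -/

namespace DefinableTypes

section OneVariable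

open Polynomial

variable {M Γ₀ : Type*} [Field M] [LinearOrderedCommGroupWithZero Γ₀] (w : Valuation M Γ₀)

/-- Take a root `u` of `∏ (X - s) = 1`, with `s` running over 0 and the integral elements of `S`.
Such a root is integral, so all factors have valuation at most 1. Their product has valuation 1, so
each of them does. -/
theorem exists_generic_unit [IsAlgClosed M] (S : Finset M) :
    ∃ u, w u = 1 ∧ ∀ s ∈ S, 1 ≤ w (u - s) := by
  classical
  set T : Finset M := insert 0 (S.filter fun s => w s ≤ 1) with hT
  have hT1 : ∀ s ∈ T, w s ≤ 1 := by
    intro s hs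
    rcases Finset.mem_insert.1 hs with rfl | hs
    · simp
    · exact (Finset.mem_filter.1 hs).2
  set p : M[X] := ∏ s ∈ T, (X - C s) with hp
  have hpm : p.Monic := monic_prod_of_monic _ _ fun s _ => monic_X_sub_C s
  have hpd : 0 < p.natDegree := by
    rw [hp, natDegree_prod_of_monic _ _ fun s _ => monic_X_sub_C s]
    simp only [natDegree_X_sub_C, Finset.sum_const, smul_eq_mul, mul_one]
    exact Finset.card_pos.2 ⟨0, Finset.mem_insert_self _ _⟩
  have hdeg : (p - C 1).degree ≠ 0 := by
    rw [degree_sub_C (natDegree_pos_iff_degree_pos.1 hpd)]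
    exact (natDegree_pos_iff_degree_pos.1 hpd).ne'
  obtain ⟨u, hu⟩ := IsAlgClosed.exists_root _ hdeg
  have hprod : ∏ s ∈ T, (u - s) = 1 := by
    have := hu
    simp only [IsRoot.def, eval_sub, eval_C, hp, eval_prod, eval_X] at this
    exact sub_eq_zero.1 this
  have hwprod : ∏ s ∈ T, w (u - s) = 1 := by rw [← map_prod, hprod, map_one]
  have hu1 : w u ≤ 1 := by
    by_contra hcon
    push Not at hcon
    have : ∀ s ∈ T, w (u - s) = w u := fun s hs =>
      Valuation.map_sub_eq_of_lt_left _ ((hT1 s hs).trans_lt hcon)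
    rw [Finset.prod_congr rfl this, Finset.prod_const] at hwprod
    exact absurd hwprod
      (one_lt_pow' hcon (Finset.card_pos.2 ⟨0, Finset.mem_insert_self _ _⟩).ne').ne'
  have hle : ∀ s ∈ T, w (u - s) ≤ 1 := fun s hs =>
    (w.map_sub _ _).trans (max_le hu1 (hT1 s hs))
  have heq : ∀ s ∈ T, w (u - s) = 1 := by
    intro s hs
    refine le_antisymm (hle s hs) (not_lt.1 fun hlt => ?_)
    rw [← Finset.mul_prod_erase _ _ hs] at hwprod
    exact absurd hwprod (mul_lt_one_of_lt_of_le hlt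
      (Finset.prod_le_one' fun r hr => hle r (Finset.mem_of_mem_erase hr))).ne
  have hu' : w u = 1 := by simpa using heq 0 (Finset.mem_insert_self _ _)
  refine ⟨u, hu', fun s hs => ?_⟩
  rcases le_or_gt (w s) 1 with h | h
  · exact (heq s (Finset.mem_insert_of_mem (Finset.mem_filter.2 ⟨hs, h⟩))).ge
  · rw [Valuation.map_sub_eq_of_lt_right _ (by rw [hu']; exact h)]
    exact h.le

theorem map_unit_sub {u s : M} (hu : w u = 1) (h : 1 ≤ w (u - s)) : w (u - s) = max 1 (w s) := by
  rcases le_or_gt (w s) 1 with hs | hs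
  · rw [max_eq_left hs]
    exact le_antisymm ((w.map_sub _ _).trans (max_le hu.le hs)) h
  · rw [max_eq_right hs.le]
    exact Valuation.map_sub_eq_of_lt_right _ (by rw [hu]; exact hs)

theorem exists_valuation_gt (hw : ∃ t, t ≠ 0 ∧ w t < 1) (s : M) : ∃ u, w s < w u := by
  obtain ⟨t, ht0, ht⟩ := hw
  by_cases hs : s = 0
  · exact ⟨1, by simp [hs]⟩
  · refine ⟨s * t⁻¹, ?_⟩
    rw [map_mul, map_inv₀]
    exact lt_mul_of_one_lt_right (zero_lt_iff.2 ((Valuation.ne_zero_iff _).2 hs))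
      ((one_lt_inv₀ (zero_lt_iff.2 ((Valuation.ne_zero_iff _).2 ht0))).2 ht)

theorem exists_valuation_between [IsAlgClosed M] (hw : ∃ t, t ≠ 0 ∧ w t < 1) {s r : M}
    (hsr : w s < w r) : ∃ u, w s < w u ∧ w u < w r := by
  have hr : 0 < w r := zero_le.trans_lt hsr
  by_cases hs : s = 0
  · obtain ⟨t, ht0, ht⟩ := hw
    refine ⟨r * t, ?_, ?_⟩
    · rw [hs, map_zero, map_mul]
      exact mul_pos hr (zero_lt_iff.2 ((Valuation.ne_zero_iff _).2 ht0))
    · rw [map_mul]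
      exact mul_lt_of_lt_one_right hr ht
  · have hs : 0 < w s := zero_lt_iff.2 ((Valuation.ne_zero_iff _).2 hs)
    obtain ⟨u, hu⟩ := IsAlgClosed.exists_pow_nat_eq (s * r) (n := 2) two_pos
    have hu2 : w u ^ 2 = w s * w r := by rw [← map_pow, hu, map_mul]
    refine ⟨u, ?_, ?_⟩
    · refine lt_of_pow_lt_pow_left₀ 2 zero_le ?_
      rw [hu2, sq]
      exact mul_lt_mul_of_pos_left hsr hs
    · refine lt_of_pow_lt_pow_left₀ 2 zero_le ?_
      rw [hu2, sq]
      exact mul_lt_mul_of_pos_right hsr hr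

variable {M₁ Γ₁ M₂ Γ₂ N : Type*} [Field M₁] [LinearOrderedCommGroupWithZero Γ₁]
  [Field M₂] [LinearOrderedCommGroupWithZero Γ₂] [Field N]
  {w₁ : Valuation M₁ Γ₁} {w₂ : Valuation M₂ Γ₂} {τ₁ : N →+* M₁} {τ₂ : N →+* M₂}

/-- The value group of `M₂` is dense, by square roots, and unbounded. A cut of a finite set of
values that is not attained in `G` can therefore be filled strictly between its neighbours. -/
theorem exists_same_cut [IsAlgClosed M₂] (hw : ∃ t, t ≠ 0 ∧ w₂ t < 1)
    (h : ∀ a b, w₁ (τ₁ a) ≤ w₁ (τ₁ b) ↔ w₂ (τ₂ a) ≤ w₂ (τ₂ b)) {δ : Γ₁} (hδ : δ ≠ 0)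
    (G : Finset N) :
    ∃ t : M₂, t ≠ 0 ∧ ∀ g ∈ G, (δ ≤ w₁ (τ₁ g) ↔ w₂ t ≤ w₂ (τ₂ g)) ∧
      (w₁ (τ₁ g) ≤ δ ↔ w₂ (τ₂ g) ≤ w₂ t) := by
  classical
  by_cases hex : ∃ g ∈ G, w₁ (τ₁ g) = δ
  · obtain ⟨g, -, rfl⟩ := hex
    refine ⟨τ₂ g, ?_, fun g' _ => ⟨h _ _, h _ _⟩⟩
    rintro h0
    rw [map_eq_zero] at h0
    simp [h0] at hδ
  push Not at hex
  have hlt : ∀ a b, w₁ (τ₁ a) < w₁ (τ₁ b) ↔ w₂ (τ₂ a) < w₂ (τ₂ b) := fun a b => by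
    rw [← not_le, ← not_le, h]
  obtain ⟨l, hl, hlmax⟩ := Finset.exists_max_image
    (insert 0 (G.filter fun g => w₁ (τ₁ g) < δ)) (fun g => w₁ (τ₁ g)) ⟨0, Finset.mem_insert_self _ _⟩
  have hlδ : w₁ (τ₁ l) < δ := by
    rcases Finset.mem_insert.1 hl with rfl | hl
    · simpa using zero_lt_iff.2 hδ
    · exact (Finset.mem_filter.1 hl).2
  obtain ⟨t, ht1, ht2⟩ : ∃ t, w₂ (τ₂ l) < w₂ t ∧ ∀ g ∈ G, δ < w₁ (τ₁ g) → w₂ t < w₂ (τ₂ g) := by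
    by_cases hne : (G.filter fun g => δ < w₁ (τ₁ g)).Nonempty
    · obtain ⟨m, hm, hmmin⟩ := Finset.exists_min_image _ (fun g => w₁ (τ₁ g)) hne
      obtain ⟨t, h1, h2⟩ := exists_valuation_between w₂ hw
        ((hlt l m).1 (hlδ.trans (Finset.mem_filter.1 hm).2))
      exact ⟨t, h1, fun g hg hgδ =>
        h2.trans_le ((h _ _).1 (hmmin g (Finset.mem_filter.2 ⟨hg, hgδ⟩)))⟩
    · obtain ⟨t, h1⟩ := exists_valuation_gt w₂ hw (τ₂ l)
      exact ⟨t, h1, fun g hg hgδ => absurd ⟨g, Finset.mem_filter.2 ⟨hg, hgδ⟩⟩ hne⟩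
  refine ⟨t, ?_, fun g hg => ?_⟩
  · rintro rfl
    simp at ht1
  · rcases lt_or_gt_of_ne (hex g hg) with h1 | h1
    · have h2 : w₂ (τ₂ g) < w₂ t := ((h _ _).1 (hlmax g (Finset.mem_insert_of_mem
        (Finset.mem_filter.2 ⟨hg, h1⟩)))).trans_lt ht1
      exact ⟨iff_of_false (not_le.2 h1) (not_le.2 h2), iff_of_true h1.le h2.le⟩
    · have h2 := ht2 g hg h1
      exact ⟨iff_of_true h1.le h2.le, iff_of_false (not_le.2 h1) (not_le.2 h2)⟩

/-- For a common multiple `n` of the nonzero exponents, comparing `γ ^ k` times the value of `g`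
with that of `e` amounts to comparing `γ ^ n` with the value of `(e / g) ^ (n / k)`. This is a
simple cut, and an `n`-th root of its solution serves. -/
theorem exists_same_monomial_cut [IsAlgClosed M₂] (hw : ∃ t, t ≠ 0 ∧ w₂ t < 1)
    (h : ∀ a b, w₁ (τ₁ a) ≤ w₁ (τ₁ b) ↔ w₂ (τ₂ a) ≤ w₂ (τ₂ b)) {γ : Γ₁} (hγ : γ ≠ 0)
    (T : Finset (ℕ × N × N)) :
    ∃ t : M₂, t ≠ 0 ∧ ∀ k g e, (k, g, e) ∈ T →
      (γ ^ k * w₁ (τ₁ g) ≤ w₁ (τ₁ e) ↔ w₂ t ^ k * w₂ (τ₂ g) ≤ w₂ (τ₂ e)) ∧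
      (w₁ (τ₁ e) ≤ γ ^ k * w₁ (τ₁ g) ↔ w₂ (τ₂ e) ≤ w₂ t ^ k * w₂ (τ₂ g)) := by
  classical
  set n : ℕ := ∏ q ∈ T, if q.1 = 0 then 1 else q.1 with hn
  have hn0 : 0 < n := Finset.prod_pos fun q _ => by split_ifs <;> omega
  have hdvd : ∀ k g e, (k, g, e) ∈ T → k ≠ 0 → k ∣ n := by
    intro k g e hT hk
    have := Finset.dvd_prod_of_mem (fun q : ℕ × N × N => if q.1 = 0 then 1 else q.1) hT
    simpa [hk] using this
  obtain ⟨t₀, ht₀, hcut⟩ := exists_same_cut hw h (pow_ne_zero n hγ)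
    (T.image fun q => (q.2.2 / q.2.1) ^ (n / q.1))
  obtain ⟨t, rfl⟩ := IsAlgClosed.exists_pow_nat_eq t₀ hn0
  have ht : t ≠ 0 := by rintro rfl; exact ht₀ (zero_pow hn0.ne')
  refine ⟨t, ht, fun k g e hT => ?_⟩
  by_cases hk : k = 0
  · simp only [hk, pow_zero, one_mul]
    exact ⟨h _ _, h _ _⟩
  by_cases hg : g = 0
  · simp only [hg, map_zero, mul_zero]
    exact ⟨by simp, by simp⟩
  obtain ⟨m, hm⟩ := hdvd k g e hT hk
  have hm0 : m ≠ 0 := by rintro rfl; simp at hm; omega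
  have hnk : n / k = m := by rw [hm]; exact Nat.mul_div_cancel_left _ (Nat.pos_of_ne_zero hk)
  have hmem : (e / g) ^ m ∈ T.image fun q => (q.2.2 / q.2.1) ^ (n / q.1) :=
    Finset.mem_image.2 ⟨(k, g, e), hT, by simp only [hnk]⟩
  have hc := hcut _ hmem
  rw [hm, pow_mul, map_pow, map_pow, map_pow, map_pow, map_pow, pow_mul,
    pow_le_pow_iff_left₀ zero_le zero_le hm0, pow_le_pow_iff_left₀ zero_le zero_le hm0,
    pow_le_pow_iff_left₀ zero_le zero_le hm0, pow_le_pow_iff_left₀ zero_le zero_le hm0] at hc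
  have hg1 : 0 < w₁ (τ₁ g) := zero_lt_iff.2 (by simpa using hg)
  have hg2 : 0 < w₂ (τ₂ g) := zero_lt_iff.2 (by simpa using hg)
  simp only [map_div₀] at hc
  rw [le_div_iff₀ hg1, le_div_iff₀ hg2, div_le_iff₀ hg1, div_le_iff₀ hg2] at hc
  exact hc

/-- In the factorization into linear factors, each root close to `c` contributes `γ`, and each far
root `e` contributes the value of `c - e`. The value of `P` at `x` is thus a monomial in `γ` with
coefficient from `N`. -/
theorem valuation_eval₂_eq_of_roots {τ : N →+* M} {P : N[X]} (hP : P.Splits) {x : M} {c : N}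
    {γ : Γ₀} (hx : ∀ e ∈ P.roots, w (x - τ e) = max γ (w (τ (c - e)))) {far : N → Prop}
    [DecidablePred far] (hfar : ∀ e ∈ P.roots, far e ↔ γ < w (τ (c - e))) :
    w (P.eval₂ τ x) = γ ^ (P.roots.filter fun e => ¬ far e).card *
      w (τ (P.leadingCoeff * ((P.roots.filter far).map fun e => c - e).prod)) := by
  have hprod : ∀ s : Multiset N, (∀ e ∈ s, e ∈ P.roots) →
      (s.map fun e => w (x - τ e)).prod = γ ^ (s.filter fun e => ¬ far e).card *
        w (τ ((s.filter far).map fun e => c - e).prod) := by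
    intro s
    induction s using Multiset.induction with
    | empty => simp
    | cons a s ih =>
      intro hs
      have ha := hs a (Multiset.mem_cons_self a s)
      have ih' := ih fun e he => hs e (Multiset.mem_cons_of_mem he)
      rw [Multiset.map_cons, Multiset.prod_cons, ih', hx a ha]
      by_cases hf : far a
      · have hneg : (a ::ₘ s).filter (fun e => ¬ far e) = s.filter fun e => ¬ far e :=
          Multiset.filter_cons_of_neg _ (not_not.2 hf)
        rw [Multiset.filter_cons_of_pos _ hf, hneg, max_eq_right ((hfar a ha).1 hf).le,
          Multiset.map_cons, Multiset.prod_cons, map_mul, map_mul, mul_left_comm]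
      · have hpos : (a ::ₘ s).filter (fun e => ¬ far e) = a ::ₘ s.filter fun e => ¬ far e :=
          Multiset.filter_cons_of_pos _ hf
        rw [Multiset.filter_cons_of_neg _ hf, hpos, max_eq_left (not_lt.1 fun hlt => hf ((hfar a ha).2 hlt)), Multiset.card_cons, pow_succ']
        rw [mul_assoc]
  have heval : P.eval₂ τ x = τ P.leadingCoeff * (P.roots.map fun e => x - τ e).prod := by
    conv_lhs => rw [hP.eq_prod_roots]
    rw [eval₂_mul, eval₂_C, eval₂_multiset_prod, Multiset.map_map]
    congr 3
    ext e
    simp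
  rw [heval, map_mul, map_multiset_prod, Multiset.map_map]
  have h1 := hprod P.roots fun _ h => h
  simp only [Function.comp_def]
  rw [h1, map_mul τ, map_mul w]
  exact mul_left_comm _ _ _

/-- With `c` a nearest root to `x` and `γ` the distance, all values are monomials in `γ`. The point
`x'` is `c + t * u`, where the value of `t` imitates `γ` and the unit `u` is generic enough to keep
`x'` from approaching any root further. -/
theorem exists_same_pattern_of_splits [IsAlgClosed M₂] (hw : ∃ t, t ≠ 0 ∧ w₂ t < 1)
    (h : ∀ a b, w₁ (τ₁ a) ≤ w₁ (τ₁ b) ↔ w₂ (τ₂ a) ≤ w₂ (τ₂ b))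
    {ι : Type*} [Finite ι] {P : ι → N[X]} (hP : ∀ i, (P i).Splits) (x : M₁) :
    ∃ x' : M₂, ∀ i j, w₁ ((P i).eval₂ τ₁ x) ≤ w₁ ((P j).eval₂ τ₁ x) ↔
      w₂ ((P i).eval₂ τ₂ x') ≤ w₂ ((P j).eval₂ τ₂ x') := by
  classical
  cases nonempty_fintype ι
  set R : Finset N := insert 0 (Finset.univ.biUnion fun i => (P i).roots.toFinset) with hR
  have hroots : ∀ i, ∀ e ∈ (P i).roots, e ∈ R := fun i e he =>
    Finset.mem_insert_of_mem (Finset.mem_biUnion.2 ⟨i, Finset.mem_univ i, Multiset.mem_toFinset.2 he⟩)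
  obtain ⟨c, hc, hcmin⟩ := Finset.exists_min_image R (fun e => w₁ (x - τ₁ e))
    ⟨0, Finset.mem_insert_self _ _⟩
  by_cases hxc : x = τ₁ c
  · refine ⟨τ₂ c, fun i j => ?_⟩
    simp only [hxc, eval₂_at_apply, h]
  set γ := w₁ (x - τ₁ c) with hγ
  have hγ0 : γ ≠ 0 := by simpa [hγ, sub_eq_zero] using hxc
  have hmax : ∀ e ∈ R, w₁ (x - τ₁ e) = max γ (w₁ (τ₁ (c - e))) := by
    intro e he
    have hsplit : x - τ₁ e = (x - τ₁ c) + τ₁ (c - e) := by rw [map_sub]; ring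
    refine le_antisymm (by rw [hsplit]; exact w₁.map_add _ _) (max_le (hcmin e he) ?_)
    have : τ₁ (c - e) = (x - τ₁ e) - (x - τ₁ c) := by rw [map_sub]; ring
    rw [this]
    exact (w₁.map_sub _ _).trans (max_le le_rfl (hcmin e he))
  let far : N → Prop := fun e => γ < w₁ (τ₁ (c - e))
  let k : ι → ℕ := fun i => ((P i).roots.filter fun e => ¬ far e).card
  let g : ι → N := fun i =>
    (P i).leadingCoeff * (((P i).roots.filter far).map fun e => c - e).prod
  have h1 : ∀ i, w₁ ((P i).eval₂ τ₁ x) = γ ^ k i * w₁ (τ₁ (g i)) := fun i =>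
    valuation_eval₂_eq_of_roots w₁ (hP i) (fun e he => hmax e (hroots i e he)) fun e _ => Iff.rfl
  -- The first family of constraints decides which roots are far. The second compares the values of
  -- the polynomials after cancelling the smaller power of `γ`; since the subtraction of exponents
  -- is truncated, the pair is swapped when `k i < k j`.
  obtain ⟨t, ht0, ht⟩ := exists_same_monomial_cut hw h hγ0
    ((R.image fun e => (1, 1, c - e)) ∪
      (Finset.univ.image fun q : ι × ι => (k q.1 - k q.2, g q.1, g q.2)))
  have hwt : w₂ t ≠ 0 := (Valuation.ne_zero_iff _).2 ht0
  obtain ⟨u, hu1, hu⟩ := exists_generic_unit w₂ (R.image fun e => τ₂ (e - c) / t)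
  have hmax' : ∀ e ∈ R, w₂ (τ₂ c + t * u - τ₂ e) = max (w₂ t) (w₂ (τ₂ (c - e))) := by
    intro e he
    have h2 := map_unit_sub w₂ hu1 (hu _ (Finset.mem_image_of_mem _ he))
    have h3 : τ₂ c + t * u - τ₂ e = t * (u - τ₂ (e - c) / t) := by
      rw [map_sub]; field_simp; ring
    have hmono : Monotone (w₂ t * ·) := fun a b hab => mul_le_mul_right hab _
    rw [h3, map_mul, h2, hmono.map_max, mul_one, map_div₀,
      mul_div_cancel₀ _ hwt, ← neg_sub c e, map_neg τ₂, Valuation.map_neg]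
  have hfar' : ∀ e ∈ R, far e ↔ w₂ t < w₂ (τ₂ (c - e)) := by
    intro e he
    have := (ht 1 1 (c - e) (Finset.mem_union_left _ (Finset.mem_image_of_mem _ he))).2
    simp only [pow_one, map_one, mul_one] at this
    rw [← not_le, ← this, not_le]
  have h2 : ∀ i, w₂ ((P i).eval₂ τ₂ (τ₂ c + t * u)) = w₂ t ^ k i * w₂ (τ₂ (g i)) := fun i =>
    valuation_eval₂_eq_of_roots w₂ (hP i) (fun e he => hmax' e (hroots i e he))
      fun e he => hfar' e (hroots i e he)
  refine ⟨τ₂ c + t * u, fun i j => ?_⟩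
  rw [h1, h1, h2, h2]
  rcases le_total (k j) (k i) with hij | hij
  · have := (ht _ _ _ (Finset.mem_union_right _ (Finset.mem_image_of_mem _
      (Finset.mem_univ (i, j))))).1
    simp only at this
    conv_lhs => rw [← Nat.sub_add_cancel hij, pow_add, mul_comm (γ ^ (k i - k j)), mul_assoc]
    conv_rhs => rw [← Nat.sub_add_cancel hij, pow_add, mul_comm (w₂ t ^ (k i - k j)), mul_assoc]
    rw [mul_le_mul_iff_right₀ (zero_lt_iff.2 (pow_ne_zero _ hγ0)),
      mul_le_mul_iff_right₀ (zero_lt_iff.2 (pow_ne_zero _ hwt)), this]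
  · have := (ht _ _ _ (Finset.mem_union_right _ (Finset.mem_image_of_mem _
      (Finset.mem_univ (j, i))))).2
    simp only at this
    conv_lhs => rw [← Nat.sub_add_cancel hij, pow_add, mul_comm (γ ^ (k j - k i)), mul_assoc]
    conv_rhs => rw [← Nat.sub_add_cancel hij, pow_add, mul_comm (w₂ t ^ (k j - k i)), mul_assoc]
    rw [mul_le_mul_iff_right₀ (zero_lt_iff.2 (pow_ne_zero _ hγ0)),
      mul_le_mul_iff_right₀ (zero_lt_iff.2 (pow_ne_zero _ hwt)), this]

/-- Embed `N` in both fields. The two induced valuation rings have the same trace on `A`, so an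
automorphism of `N` over `A` corrects the second embedding until the induced orders on `N` agree. -/
theorem exists_same_pattern_of_normal {A : Type*} [Field A] [Algebra A N] [Algebra A M₁]
    [Algebra A M₂] [FiniteDimensional A N] [Normal A N] [IsAlgClosed M₁] [IsAlgClosed M₂]
    (hw : ∃ t, t ≠ 0 ∧ w₂ t < 1)
    (h : ∀ a b, w₁ (algebraMap A M₁ a) ≤ w₁ (algebraMap A M₁ b) ↔
      w₂ (algebraMap A M₂ a) ≤ w₂ (algebraMap A M₂ b))
    {ι : Type*} [Finite ι] (P : ι → A[X]) (hP : ∀ i, ((P i).map (algebraMap A N)).Splits) (x : M₁) :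
    ∃ x' : M₂, ∀ i j, w₁ (aeval x (P i)) ≤ w₁ (aeval x (P j)) ↔
      w₂ (aeval x' (P i)) ≤ w₂ (aeval x' (P j)) := by
  let τ₁ : N →ₐ[A] M₁ := IsAlgClosed.lift
  let τ₂ : N →ₐ[A] M₂ := IsAlgClosed.lift
  have hA : ∀ a : A, w₁ (τ₁ (algebraMap A N a)) ≤ 1 ↔ w₂ (τ₂ (algebraMap A N a)) ≤ 1 := fun a => by
    simpa using h a 1
  obtain ⟨σ, hσ⟩ := exists_eq_comap (A := A) ((w₂.comap (τ₂ : N →+* M₂)).valuationSubring)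
    ((w₁.comap (τ₁ : N →+* M₁)).valuationSubring) (by
      ext y
      constructor
      · rintro ⟨hy, a, rfl⟩
        exact ⟨(hA a).2 hy, a, rfl⟩
      · rintro ⟨hy, a, rfl⟩
        exact ⟨(hA a).1 hy, a, rfl⟩)
  let τ₂' : N →ₐ[A] M₂ := τ₂.comp (σ : N →ₐ[A] N)
  have hone : ∀ a, w₁ (τ₁ a) ≤ 1 ↔ w₂ (τ₂' a) ≤ 1 := by
    intro a
    have h1 : a ∈ (w₁.comap (τ₁ : N →+* M₁)).valuationSubring ↔ w₁ (τ₁ a) ≤ 1 := Iff.rfl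
    rw [← h1, ← hσ]
    exact Iff.rfl
  have hN : ∀ a b, w₁ ((τ₁ : N →+* M₁) a) ≤ w₁ ((τ₁ : N →+* M₁) b) ↔
      w₂ ((τ₂' : N →+* M₂) a) ≤ w₂ ((τ₂' : N →+* M₂) b) := by
    intro a b
    simp only [RingHom.coe_coe]
    by_cases hb : b = 0
    · simp [hb]
    · have h1 : 0 < w₁ (τ₁ b) := zero_lt_iff.2 (by simpa using hb)
      have h2 : 0 < w₂ (τ₂' b) := zero_lt_iff.2 (by simpa using hb)
      have := hone (a / b)
      rwa [map_div₀, map_div₀, map_div₀, map_div₀, div_le_one₀ h1, div_le_one₀ h2] at this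
  obtain ⟨x', hx'⟩ := exists_same_pattern_of_splits hw hN hP x
  refine ⟨x', fun i j => ?_⟩
  have e1 : (τ₁ : N →+* M₁).comp (algebraMap A N) = algebraMap A M₁ := τ₁.comp_algebraMap
  have e2 : (τ₂' : N →+* M₂).comp (algebraMap A N) = algebraMap A M₂ := τ₂'.comp_algebraMap
  have := hx' i j
  simpa only [eval₂_map, e1, e2, ← aeval_def] using this

theorem exists_same_pattern_of_field {A : Type*} [Field A] [IsAlgClosed M₁] [IsAlgClosed M₂]
    (hw : ∃ t, t ≠ 0 ∧ w₂ t < 1) {f₁ : A →+* M₁} {f₂ : A →+* M₂}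
    (h : ∀ a b, w₁ (f₁ a) ≤ w₁ (f₁ b) ↔ w₂ (f₂ a) ≤ w₂ (f₂ b))
    {ι : Type*} [Finite ι] (P : ι → A[X]) (x : M₁) :
    ∃ x' : M₂, ∀ i j, w₁ ((P i).eval₂ f₁ x) ≤ w₁ ((P j).eval₂ f₁ x) ↔
      w₂ ((P i).eval₂ f₂ x') ≤ w₂ ((P j).eval₂ f₂ x') := by
  classical
  cases nonempty_fintype ι
  -- Zero polynomials are replaced by 1 so that the splitting field of `Q` splits every `P i`.
  let Q : A[X] := ∏ i, if P i = 0 then 1 else P i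
  have hQ0 : Q ≠ 0 := Finset.prod_ne_zero_iff.2 fun i _ => by split_ifs with hi <;> simp [hi]
  have hPs : ∀ i, ((P i).map (algebraMap A Q.SplittingField)).Splits := by
    intro i
    by_cases hi : P i = 0
    · simp [hi]
    · refine (SplittingField.splits Q).of_dvd
        ((Polynomial.map_ne_zero_iff (algebraMap A Q.SplittingField).injective).2 hQ0)
        (Polynomial.map_dvd _ ?_)
      have := Finset.dvd_prod_of_mem (fun i => if P i = 0 then 1 else P i) (Finset.mem_univ i)
      simpa [hi] using this
  let := f₁.toAlgebra
  let := f₂.toAlgebra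
  have : Normal A Q.SplittingField := Normal.of_isSplittingField Q
  exact exists_same_pattern_of_normal (N := Q.SplittingField) hw h P hPs x

/-- Comparison with 0 shows that `f₁` and `f₂` have the same kernel, a prime ideal. Both maps then
extend to the fraction field of the quotient, and clearing denominators transfers the hypothesis. -/
theorem exists_same_pattern {R : Type*} [CommRing R] [IsAlgClosed M₁] [IsAlgClosed M₂]
    (hw : ∃ t, t ≠ 0 ∧ w₂ t < 1) {f₁ : R →+* M₁} {f₂ : R →+* M₂}
    (h : ∀ a b, w₁ (f₁ a) ≤ w₁ (f₁ b) ↔ w₂ (f₂ a) ≤ w₂ (f₂ b))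
    {ι : Type*} [Finite ι] (P : ι → R[X]) (x : M₁) :
    ∃ x' : M₂, ∀ i j, w₁ ((P i).eval₂ f₁ x) ≤ w₁ ((P j).eval₂ f₁ x) ↔
      w₂ ((P i).eval₂ f₂ x') ≤ w₂ ((P j).eval₂ f₂ x') := by
  have hker : ∀ r, f₁ r = 0 ↔ f₂ r = 0 := fun r => by simpa using h r 0
  let I : Ideal R := RingHom.ker f₁
  have : I.IsPrime := RingHom.ker_isPrime f₁
  let g₁ : R ⧸ I →+* M₁ := Ideal.Quotient.lift I f₁ fun r hr => hr
  let g₂ : R ⧸ I →+* M₂ := Ideal.Quotient.lift I f₂ fun r hr => (hker r).1 hr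
  have hg₁ : Function.Injective g₁ := (injective_iff_map_eq_zero g₁).2 fun y hy => by
    obtain ⟨r, rfl⟩ := Ideal.Quotient.mk_surjective y
    exact Ideal.Quotient.eq_zero_iff_mem.2 hy
  have hg₂ : Function.Injective g₂ := (injective_iff_map_eq_zero g₂).2 fun y hy => by
    obtain ⟨r, rfl⟩ := Ideal.Quotient.mk_surjective y
    exact Ideal.Quotient.eq_zero_iff_mem.2 ((hker r).2 hy)
  let A := FractionRing (R ⧸ I)
  let k₁ : A →+* M₁ := IsFractionRing.lift hg₁
  let k₂ : A →+* M₂ := IsFractionRing.lift hg₂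
  have hk₁ : ∀ y, k₁ (algebraMap (R ⧸ I) A y) = g₁ y := IsFractionRing.lift_algebraMap hg₁
  have hk₂ : ∀ y, k₂ (algebraMap (R ⧸ I) A y) = g₂ y := IsFractionRing.lift_algebraMap hg₂
  let q : R →+* A := (algebraMap (R ⧸ I) A).comp (Ideal.Quotient.mk I)
  have e1 : k₁.comp q = f₁ := RingHom.ext fun r => hk₁ _
  have e2 : k₂.comp q = f₂ := RingHom.ext fun r => hk₂ _
  have hfrac : ∀ a : A, ∃ r s : R, q s ≠ 0 ∧ a = q r / q s := by
    intro a
    obtain ⟨y, z, hz, rfl⟩ := IsFractionRing.div_surjective (A := R ⧸ I) a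
    obtain ⟨r, rfl⟩ := Ideal.Quotient.mk_surjective y
    obtain ⟨s, rfl⟩ := Ideal.Quotient.mk_surjective z
    refine ⟨r, s, ?_, rfl⟩
    exact IsFractionRing.to_map_ne_zero_of_mem_nonZeroDivisors (R := R ⧸ I) hz
  have hA : ∀ a b, w₁ (k₁ a) ≤ w₁ (k₁ b) ↔ w₂ (k₂ a) ≤ w₂ (k₂ b) := by
    intro a b
    obtain ⟨r, s, hs, rfl⟩ := hfrac a
    obtain ⟨r', s', hs', rfl⟩ := hfrac b
    have hq1 : ∀ r, k₁ (q r) = f₁ r := fun r => RingHom.congr_fun e1 r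
    have hq2 : ∀ r, k₂ (q r) = f₂ r := fun r => RingHom.congr_fun e2 r
    have p1 : ∀ {s}, q s ≠ 0 → 0 < w₁ (f₁ s) := fun {s} hs => zero_lt_iff.2 (by
      rw [← hq1, Valuation.ne_zero_iff]; simpa using hs)
    have p2 : ∀ {s}, q s ≠ 0 → 0 < w₂ (f₂ s) := fun {s} hs => zero_lt_iff.2 (by
      rw [← hq2, Valuation.ne_zero_iff]; simpa using hs)
    rw [map_div₀, map_div₀, map_div₀, map_div₀, map_div₀, map_div₀, map_div₀, map_div₀,
      hq1, hq1, hq1, hq1, hq2, hq2, hq2, hq2,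
      div_le_div_iff₀ (p1 hs) (p1 hs'), div_le_div_iff₀ (p2 hs) (p2 hs'),
      ← map_mul, ← map_mul, ← map_mul, ← map_mul, ← map_mul, ← map_mul, ← map_mul, ← map_mul, h]
  obtain ⟨x', hx'⟩ := exists_same_pattern_of_field hw hA (fun i => (P i).map q) x
  refine ⟨x', fun i j => ?_⟩
  have := hx' i j
  simpa only [eval₂_map, e1, e2] using this

end OneVariable

end DefinableTypes

/-! ### Quantifier free definable sets -/

namespace DefinableTypes

section QuantifierFree

variable {Γ : Type*} [AddCommGroup Γ] [LinearOrder Γ] [IsOrderedAddMonoid Γ]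
  {F : Type*} [Field F] {v : AddValuation F (WithTop Γ)} {α β : Type*}

/-- The sets of tuples definable with parameters by a quantifier free formula in the language of
valued fields. -/
inductive QF (v : AddValuation F (WithTop Γ)) {α : Type*} : Set (α → F) → Prop
  | basic (P Q : MvPolynomial α F) :
      QF v {y | v (MvPolynomial.eval y P) ≤ v (MvPolynomial.eval y Q)}
  | compl {E : Set (α → F)} : QF v E → QF v Eᶜ
  | inter {E E' : Set (α → F)} : QF v E → QF v E' → QF v (E ∩ E')

namespace QF

theorem union {E E' : Set (α → F)} (h : QF v E) (h' : QF v E') : QF v (E ∪ E') := by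
  rw [← compl_compl (E ∪ E'), Set.compl_union]
  exact (h.compl.inter h'.compl).compl

theorem univ : QF v (Set.univ : Set (α → F)) := by
  have := QF.basic (v := v) (α := α) 0 0
  simpa using this

theorem empty : QF v (∅ : Set (α → F)) := by
  simpa using (univ (v := v) (α := α)).compl

theorem eq_zero (P : MvPolynomial α F) : QF v {y | MvPolynomial.eval y P = 0} := by
  have := QF.basic (v := v) 0 P
  simpa [top_le_iff] using this

theorem finite_biInter {ι : Type*} (s : Finset ι) {E : ι → Set (α → F)}
    (h : ∀ i ∈ s, QF v (E i)) : QF v {y | ∀ i ∈ s, y ∈ E i} := by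
  classical
  induction s using Finset.induction with
  | empty => simpa using univ
  | insert a s ha ih =>
    have : {y | ∀ i ∈ insert a s, y ∈ E i} = E a ∩ {y | ∀ i ∈ s, y ∈ E i} := by
      ext y; simp
    rw [this]
    exact (h a (Finset.mem_insert_self _ _)).inter
      (ih fun i hi => h i (Finset.mem_insert_of_mem hi))

theorem forall_fintype {ι : Type*} [Fintype ι] {E : ι → Set (α → F)}
    (h : ∀ i, QF v (E i)) : QF v {y | ∀ i, y ∈ E i} := by
  simpa using finite_biInter Finset.univ fun i _ => h i

theorem exists_fintype {ι : Type*} [Fintype ι] {E : ι → Set (α → F)}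
    (h : ∀ i, QF v (E i)) : QF v {y | ∃ i, y ∈ E i} := by
  have : {y | ∃ i, y ∈ E i} = {y | ∀ i, y ∈ (E i)ᶜ}ᶜ := by ext y; simp
  rw [this]
  exact (forall_fintype fun i => (h i).compl).compl

theorem preimage {E : Set (α → F)} (h : QF v E) (g : α → MvPolynomial β F) :
    QF v {y : β → F | (fun a => MvPolynomial.eval y (g a)) ∈ E} := by
  induction h with
  | basic P Q =>
    have := QF.basic (v := v) (MvPolynomial.bind₁ g P) (MvPolynomial.bind₁ g Q)
    have hb : ∀ (y : β → F) (P : MvPolynomial α F), MvPolynomial.eval y (MvPolynomial.bind₁ g P) =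
        MvPolynomial.eval (fun a => MvPolynomial.eval y (g a)) P := fun y P =>
      MvPolynomial.eval₂Hom_bind₁ _ _ _ _
    simp only [hb] at this
    exact this
  | compl _ ih => exact ih.compl
  | inter _ _ ih ih' => exact ih.inter ih'

theorem reindex {E : Set (α → F)} (h : QF v E) (g : α → β) :
    QF v {y : β → F | y ∘ g ∈ E} := by
  have := h.preimage fun a => MvPolynomial.X (R := F) (g a)
  simpa [Function.comp_def] using this

/-- A quantifier free definable set only depends on finitely many divisibilities. -/
theorem exists_finset_pattern {E : Set (α → F)} (h : QF v E) :
    ∃ T : Finset (MvPolynomial α F), ∀ z z' : α → F,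
      (∀ P ∈ T, ∀ Q ∈ T, v (MvPolynomial.eval z P) ≤ v (MvPolynomial.eval z Q) ↔
        v (MvPolynomial.eval z' P) ≤ v (MvPolynomial.eval z' Q)) → (z ∈ E ↔ z' ∈ E) := by
  classical
  induction h with
  | basic P Q =>
    exact ⟨{P, Q}, fun z z' h => h P (by simp) Q (by simp)⟩
  | compl _ ih =>
    obtain ⟨T, hT⟩ := ih
    exact ⟨T, fun z z' h => not_congr (hT z z' h)⟩
  | inter _ _ ih ih' =>
    obtain ⟨T, hT⟩ := ih
    obtain ⟨T', hT'⟩ := ih'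
    refine ⟨T ∪ T', fun z z' h => and_congr (hT z z' fun P hP Q hQ => ?_)
      (hT' z z' fun P hP Q hQ => ?_)⟩
    · exact h P (Finset.mem_union_left _ hP) Q (Finset.mem_union_left _ hQ)
    · exact h P (Finset.mem_union_right _ hP) Q (Finset.mem_union_right _ hQ)

/-- A set that is not quantifier free definable is separated by two ultrafilters which contain the
same quantifier free definable sets. -/
theorem exists_ultrafilters {D : Set (α → F)} (hD : ¬ QF v D) :
    ∃ U U' : Ultrafilter (α → F), D ∈ U ∧ D ∉ U' ∧ ∀ E, QF v E → (E ∈ U ↔ E ∈ U') := by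
  -- An ultrafilter finer than `f` contains `D` but no quantifier free subset of `D`.
  let f : Filter (α → F) :=
    { sets := {S | ∃ E, QF v E ∧ E ⊆ D ∧ D \ E ⊆ S}
      univ_sets := ⟨∅, empty, Set.empty_subset _, Set.subset_univ _⟩
      sets_of_superset := fun {S S'} ⟨E, h1, h2, h3⟩ hS => ⟨E, h1, h2, h3.trans hS⟩
      inter_sets := fun {S S'} ⟨E, h1, h2, h3⟩ ⟨E', h1', h2', h3'⟩ =>
        ⟨E ∪ E', h1.union h1', Set.union_subset h2 h2', fun y hy =>
          ⟨h3 ⟨hy.1, fun h => hy.2 (Or.inl h)⟩, h3' ⟨hy.1, fun h => hy.2 (Or.inr h)⟩⟩⟩ }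
  have hf : f.NeBot := by
    refine ⟨fun hbot => ?_⟩
    have : (∅ : Set (α → F)) ∈ f := by rw [hbot]; trivial
    obtain ⟨E, h1, h2, h3⟩ := this
    have hE : E = D := h2.antisymm fun y hy => by
      by_contra hyE
      exact h3 ⟨hy, hyE⟩
    exact hD (hE ▸ h1)
  let U := Ultrafilter.of f
  have hU : (U : Filter (α → F)) ≤ f := Ultrafilter.of_le f
  have hDU : D ∈ U := hU (show D ∈ f from
    ⟨∅, empty, Set.empty_subset _, fun y hy => hy.1⟩)
  have hEU : ∀ E, QF v E → E ⊆ D → E ∉ U := fun E h1 h2 hE => by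
    have h3 : D \ E ∈ U := hU (show D \ E ∈ f from ⟨E, h1, h2, subset_rfl⟩)
    have h4 := Filter.inter_mem hE h3
    rw [Set.inter_sdiff_self] at h4
    exact U.empty_notMem h4
  -- No quantifier free member of `U` is contained in `D`, so these members all meet the complement
  -- of `D`.
  let f' : Filter (α → F) :=
    { sets := {S | ∃ E, QF v E ∧ E ∈ U ∧ E \ D ⊆ S}
      univ_sets := ⟨Set.univ, univ, Filter.univ_mem, Set.subset_univ _⟩
      sets_of_superset := fun {S S'} ⟨E, h1, h2, h3⟩ hS => ⟨E, h1, h2, h3.trans hS⟩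
      inter_sets := fun {S S'} ⟨E, h1, h2, h3⟩ ⟨E', h1', h2', h3'⟩ =>
        ⟨E ∩ E', h1.inter h1', Filter.inter_mem h2 h2', fun y hy =>
          ⟨h3 ⟨hy.1.1, hy.2⟩, h3' ⟨hy.1.2, hy.2⟩⟩⟩ }
  have hf' : f'.NeBot := by
    refine ⟨fun hbot => ?_⟩
    have : (∅ : Set (α → F)) ∈ f' := by rw [hbot]; trivial
    obtain ⟨E, h1, h2, h3⟩ := this
    refine hEU E h1 (fun y hy => ?_) h2
    by_contra hyD
    exact h3 ⟨hy, hyD⟩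
  let U' := Ultrafilter.of f'
  have hU' : (U' : Filter (α → F)) ≤ f' := Ultrafilter.of_le f'
  have hsub : ∀ E, QF v E → E ∈ U → E ∈ U' := fun E h1 h2 =>
    hU' (show E ∈ f' from ⟨E, h1, h2, Set.sdiff_subset⟩)
  refine ⟨U, U', hDU, ?_, fun E hE => ⟨hsub E hE, fun h => ?_⟩⟩
  · rw [← Ultrafilter.compl_mem_iff_notMem]
    exact hU' (show Dᶜ ∈ f' from ⟨Set.univ, univ, Filter.univ_mem, fun y hy => hy.2⟩)
  · by_contra hcon
    have h1 := hsub _ hE.compl (Ultrafilter.compl_mem_iff_notMem.2 hcon)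
    exact Ultrafilter.compl_mem_iff_notMem.1 h1 h

end QF

end QuantifierFree

/-! ### Ultrapowers of valued fields and elimination of one quantifier -/

section Ultrapower

open Filter Polynomial

variable {Y F : Type*} [Field F] (U : Ultrafilter Y)

/-- A monic polynomial over the ultrapower lifts to a family of monic polynomials of the same degree
over `F`, whose roots are chosen pointwise. -/
theorem germ_isAlgClosed [IsAlgClosed F] : IsAlgClosed (Germ (U : Filter Y) F) := by
  refine IsAlgClosed.of_exists_root _ fun p hpm hpi => ?_
  have hdeg : p.natDegree ≠ 0 := hpi.natDegree_pos.ne'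
  set n := p.natDegree with hn
  have hsurj : Function.Surjective (Germ.coeRingHom (R := F) (U : Filter Y)) := Quot.mk_surjective
  choose a ha using fun i => hsurj (p.coeff i)
  let q : Y → F[X] := fun y => X ^ n + ∑ i ∈ Finset.range n, C (a i y) * X ^ i
  have hlt : ∀ y, (∑ i ∈ Finset.range n, C (a i y) * X ^ i).degree < (n : WithBot ℕ) := fun y => by
    refine (Polynomial.degree_sum_le _ _).trans_lt ((Finset.sup_lt_iff (WithBot.bot_lt_coe n)).2 ?_)
    intro i hi
    exact (degree_C_mul_X_pow_le _ _).trans_lt (Nat.cast_lt.2 (Finset.mem_range.1 hi))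
  have hq : ∀ y, (q y).degree = n := fun y => by
    rw [degree_add_eq_left_of_degree_lt] <;> rw [degree_X_pow]
    exact hlt y
  choose r hr using fun y => IsAlgClosed.exists_root (q y) (by
    rw [hq]; exact_mod_cast hdeg)
  refine ⟨Germ.coeRingHom (U : Filter Y) r, ?_⟩
  rw [eval_eq_sum_range, Finset.sum_range_succ, ← hn]
  have h1 : p.coeff n = 1 := hpm.coeff_natDegree
  rw [h1, one_mul, Finset.sum_congr rfl fun i _ => by rw [← ha i]]
  rw [← map_pow, Finset.sum_congr rfl fun i _ => by rw [← map_pow, ← map_mul], ← map_sum, ← map_add]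
  convert map_zero (Germ.coeRingHom (R := F) (U : Filter Y)) using 2
  funext y
  have := hr y
  simp only [q, IsRoot.def, eval_add, eval_pow, eval_X, eval_finsetSum, eval_mul, eval_C] at this
  simp only [Pi.add_apply, Finset.sum_apply, Pi.mul_apply, Pi.pow_apply, Pi.zero_apply]
  rw [add_comm]
  exact this

variable {Γ : Type*} [AddCommGroup Γ] [LinearOrder Γ] [IsOrderedAddMonoid Γ]
  (v : AddValuation F (WithTop Γ))

theorem val_inv {x : F} (hx : x ≠ 0) : v x⁻¹ + v x = 0 := by
  rw [← v.map_mul, inv_mul_cancel₀ hx, v.map_one]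

theorem val_nonneg_or_inv (x : F) : 0 ≤ v x ∨ 0 ≤ v x⁻¹ := by
  by_cases hx : x = 0
  · left; simp [hx]
  · rw [or_iff_not_imp_left, not_le]
    intro h
    by_contra hcon
    have := add_neg_of_neg_of_nonpos (not_le.1 hcon) h.le
    rw [val_inv v hx] at this
    exact lt_irrefl _ this

/-- The valuation ring of an ultrapower of a valued field. -/
def germValuationSubring : ValuationSubring (Germ (U : Filter Y) F) where
  carrier := {g | g.LiftPred fun x => 0 ≤ v x}
  mul_mem' := by
    intro a b
    refine Germ.inductionOn₂ a b fun f g hf hg => ?_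
    have hf : ∀ᶠ y in (U : Filter Y), 0 ≤ v (f y) := hf
    have hg : ∀ᶠ y in (U : Filter Y), 0 ≤ v (g y) := hg
    change ∀ᶠ y in (U : Filter Y), 0 ≤ v (f y * g y)
    filter_upwards [hf, hg] with y h1 h2
    rw [v.map_mul]
    exact add_nonneg h1 h2
  one_mem' := by
    change ∀ᶠ y in (U : Filter Y), 0 ≤ v (1 : F)
    simp
  add_mem' := by
    intro a b
    refine Germ.inductionOn₂ a b fun f g hf hg => ?_
    have hf : ∀ᶠ y in (U : Filter Y), 0 ≤ v (f y) := hf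
    have hg : ∀ᶠ y in (U : Filter Y), 0 ≤ v (g y) := hg
    change ∀ᶠ y in (U : Filter Y), 0 ≤ v (f y + g y)
    filter_upwards [hf, hg] with y h1 h2
    exact v.map_le_add h1 h2
  zero_mem' := by
    change ∀ᶠ y in (U : Filter Y), 0 ≤ v (0 : F)
    simp
  neg_mem' := by
    intro a
    refine Germ.inductionOn a fun f hf => ?_
    have hf : ∀ᶠ y in (U : Filter Y), 0 ≤ v (f y) := hf
    change ∀ᶠ y in (U : Filter Y), 0 ≤ v (-f y)
    simpa only [v.map_neg] using hf
  mem_or_inv_mem' := by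
    intro a
    refine Germ.inductionOn a fun f => ?_
    change (∀ᶠ y in (U : Filter Y), 0 ≤ v (f y)) ∨ ∀ᶠ y in (U : Filter Y), 0 ≤ v (f y)⁻¹
    rw [← Ultrafilter.eventually_or]
    exact Eventually.of_forall fun y => val_nonneg_or_inv v (f y)

theorem val_nonneg_div_iff {x y : F} (hy : y ≠ 0) : 0 ≤ v (x / y) ↔ v y ≤ v x := by
  have hxy : v x = v (x / y) + v y := by rw [← v.map_mul, div_mul_cancel₀ _ hy]
  constructor
  · intro h
    rw [hxy]
    exact le_add_of_nonneg_left h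
  · intro h
    by_contra hcon
    rw [hxy] at h
    have hvy : v y ≠ ⊤ := (v.ne_top_iff).2 hy
    lift v y to Γ using hvy with a
    have h2 : v (x / y) < 0 := not_le.1 hcon
    lift v (x / y) to Γ using h2.ne_top with b
    norm_cast at h h2
    exact absurd h (not_le.2 (add_lt_of_neg_left a h2))

theorem germ_valuation_le_iff (f g : Y → F) :
    (germValuationSubring U v).valuation (Germ.coeRingHom (U : Filter Y) f) ≤
      (germValuationSubring U v).valuation (Germ.coeRingHom (U : Filter Y) g) ↔
      ∀ᶠ y in (U : Filter Y), v (g y) ≤ v (f y) := by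
  by_cases hg : Germ.coeRingHom (U : Filter Y) g = 0
  · rw [hg, map_zero, le_zero_iff, map_eq_zero]
    have hg' : ∀ᶠ y in (U : Filter Y), g y = 0 := Germ.coe_eq.1 hg
    constructor
    · intro hf
      have hf' : ∀ᶠ y in (U : Filter Y), f y = 0 := Germ.coe_eq.1 hf
      filter_upwards [hf', hg'] with y h1 h2
      rw [h1, h2]
    · intro h
      refine Germ.coe_eq.2 ?_
      filter_upwards [h, hg'] with y h1 h2
      rw [h2, v.map_zero, top_le_iff, v.top_iff] at h1
      exact h1
  · have hg' : ∀ᶠ y in (U : Filter Y), g y ≠ 0 := by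
      refine Ultrafilter.eventually_not.2 fun h => hg (Germ.coe_eq.2 h)
    have h0 : 0 < (germValuationSubring U v).valuation (Germ.coeRingHom (U : Filter Y) g) :=
      zero_lt_iff.2 ((Valuation.ne_zero_iff _).2 hg)
    rw [← div_le_one₀ h0, ← map_div₀, ValuationSubring.valuation_le_one_iff]
    change (∀ᶠ y in (U : Filter Y), 0 ≤ v (f y / g y)) ↔ _
    exact Filter.eventually_congr (by
      filter_upwards [hg'] with y hy
      exact val_nonneg_div_iff v hy)

variable {α : Type*}

/-- The map from polynomials to the ultrapower of a field given by evaluation. -/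
noncomputable def germEval (U : Ultrafilter (α → F)) :
    MvPolynomial α F →+* Germ (U : Filter (α → F)) F :=
  (Germ.coeRingHom (U : Filter (α → F))).comp (RingHom.pi fun y => MvPolynomial.eval y)

theorem germEval_apply (U : Ultrafilter (α → F)) (P : MvPolynomial α F) :
    germEval U P = Germ.coeRingHom (U : Filter (α → F)) fun y => MvPolynomial.eval y P := rfl

theorem eval₂_germEval (U : Ultrafilter (α → F)) (P : (MvPolynomial α F)[X]) (x : (α → F) → F) :
    P.eval₂ (germEval U) (Germ.coeRingHom (U : Filter (α → F)) x) =
      Germ.coeRingHom (U : Filter (α → F)) fun y => P.eval₂ (MvPolynomial.eval y) (x y) := by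
  rw [germEval, ← Polynomial.hom_eval₂]
  congr 1
  funext y
  have := Polynomial.hom_eval₂ P (RingHom.pi fun y : α → F => MvPolynomial.eval y)
    (Pi.evalRingHom (fun _ : α → F => F) y) x
  exact this

theorem eval_elim_eq (P : MvPolynomial (Option α) F) (x : F) (y : α → F) :
    MvPolynomial.eval (fun o : Option α => o.elim x y) P =
      (MvPolynomial.optionEquivLeft F α P).eval₂ (MvPolynomial.eval y) x := by
  induction P using MvPolynomial.induction_on with
  | C a => simp [MvPolynomial.optionEquivLeft_C]
  | add p q hp hq => simp [hp, hq]
  | mul_X p i hp =>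
    rw [map_mul, hp, map_mul, Polynomial.eval₂_mul]
    congr 1
    cases i <;> simp [MvPolynomial.optionEquivLeft_X_none, MvPolynomial.optionEquivLeft_X_some]

variable {v}

/-- Quantifier free definable sets of an algebraically closed valued field are stable under
projections. -/
theorem QF.projection [IsAlgClosed F] (hv : ∃ t : F, t ≠ 0 ∧ v t ≠ 0) {E : Set (Option α → F)}
    (hE : QF v E) : QF v {y : α → F | ∃ x : F, (fun o : Option α => o.elim x y) ∈ E} := by
  by_contra hD
  obtain ⟨U, U', hU, hU', hUU'⟩ := QF.exists_ultrafilters hD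
  obtain ⟨T, hT⟩ := hE.exists_finset_pattern
  -- The function `x` picks a witness wherever one exists; elsewhere its value is irrelevant. Its
  -- germ along `U` is the element to transfer.
  have hx : ∀ y : α → F, ∃ x : F, (∃ x : F, (fun o : Option α => o.elim x y) ∈ E) →
      (fun o : Option α => o.elim x y) ∈ E := fun y => by
    by_cases h : ∃ x : F, (fun o : Option α => o.elim x y) ∈ E
    · exact ⟨h.choose, fun _ => h.choose_spec⟩
    · exact ⟨0, fun h' => absurd h' h⟩
  choose x hx using hx
  have := germ_isAlgClosed (F := F) U
  have := germ_isAlgClosed (F := F) U'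
  have hsurj : Function.Surjective (Germ.coeRingHom (R := F) (U' : Filter (α → F))) :=
    Quot.mk_surjective
  have hw : ∃ t : Germ (U' : Filter (α → F)) F,
      t ≠ 0 ∧ (germValuationSubring U' v).valuation t < 1 := by
    obtain ⟨t, ht0, ht⟩ : ∃ t : F, t ≠ 0 ∧ 0 < v t := by
      obtain ⟨t, ht0, ht⟩ := hv
      rcases lt_or_gt_of_ne ht with h | h
      · refine ⟨t⁻¹, inv_ne_zero ht0, ?_⟩
        rw [← not_le]
        intro hcon
        have h1 : v t⁻¹ + v t ≤ 0 + v t := add_le_add hcon le_rfl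
        rw [val_inv v ht0, zero_add] at h1
        exact absurd h (not_lt.2 h1)
      · exact ⟨t, ht0, h⟩
    refine ⟨Germ.coeRingHom (U' : Filter (α → F)) fun _ => t, ?_, ?_⟩
    · intro h
      have h' : ∀ᶠ y in (U' : Filter (α → F)), t = 0 := Germ.coe_eq.1 h
      exact ht0 (by simpa using h')
    · rw [← map_one (germValuationSubring U' v).valuation,
        ← map_one (Germ.coeRingHom (R := F) (U' : Filter (α → F))), ← not_le,
        germ_valuation_le_iff]
      simpa using ht
  obtain ⟨x', hx'⟩ := exists_same_pattern (w₁ := (germValuationSubring U v).valuation)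
    (w₂ := (germValuationSubring U' v).valuation) hw (f₁ := germEval U) (f₂ := germEval U')
    (fun a b => by
      rw [germEval_apply, germEval_apply, germEval_apply, germEval_apply,
        germ_valuation_le_iff, germ_valuation_le_iff]
      exact hUU' _ (QF.basic b a))
    (fun P : T => MvPolynomial.optionEquivLeft F α P.1)
    (Germ.coeRingHom (U : Filter (α → F)) x)
  obtain ⟨x', rfl⟩ := hsurj x'
  simp only [eval₂_germEval, germ_valuation_le_iff, ← eval_elim_eq] at hx'
  -- along each ultrafilter, all the divisibilities are eventually decided
  have key : ∀ (V : Ultrafilter (α → F)) (x : (α → F) → F), ∀ᶠ y in (V : Filter (α → F)),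
      ∀ P Q : T, v (MvPolynomial.eval (fun o : Option α => o.elim (x y) y) P.1) ≤
        v (MvPolynomial.eval (fun o : Option α => o.elim (x y) y) Q.1) ↔
        ∀ᶠ y in (V : Filter (α → F)),
          v (MvPolynomial.eval (fun o : Option α => o.elim (x y) y) P.1) ≤
          v (MvPolynomial.eval (fun o : Option α => o.elim (x y) y) Q.1) := by
    intro V x
    refine eventually_all.2 fun P => eventually_all.2 fun Q => ?_
    by_cases h : ∀ᶠ y in (V : Filter (α → F)),
          v (MvPolynomial.eval (fun o : Option α => o.elim (x y) y) P.1) ≤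
          v (MvPolynomial.eval (fun o : Option α => o.elim (x y) y) Q.1)
    · filter_upwards [h] with y hy
      exact iff_of_true hy h
    · filter_upwards [Ultrafilter.eventually_not.2 h] with y hy
      exact iff_of_false hy h
  -- At a single point `y₀` of `D` the divisibilities take their `U`-limit pattern. This is the
  -- pattern of `x' y` for `U'`-almost all `y`, so those `y` lie in `D`, against `D ∉ U'`.
  obtain ⟨y₀, hy₀, hy₀D⟩ := ((key U x).and hU).exists
  have hy₀E := hx y₀ hy₀D
  refine hU' ?_
  filter_upwards [key U' x'] with y hy
  refine ⟨x' y, (hT _ _ fun P hP Q hQ => ?_).1 hy₀E⟩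
  rw [hy₀ ⟨P, hP⟩ ⟨Q, hQ⟩, hy ⟨P, hP⟩ ⟨Q, hQ⟩]
  exact hx' ⟨Q, hQ⟩ ⟨P, hP⟩

end Ultrapower

end DefinableTypes

/-! ### Formulas and quantifier free sets; interpretation of the value group -/

namespace DefinableTypes

open FirstOrder FirstOrder.Language

/-- The addition symbol of valued fields. -/
abbrev fieldAdd : valuedFieldLang.Functions 2 := ringFunc.add

/-- The multiplication symbol of valued fields. -/
abbrev fieldMul : valuedFieldLang.Functions 2 := ringFunc.mul

/-- The divisibility symbol of valued fields. -/
abbrev fieldDiv : valuedFieldLang.Relations 2 := DivRel.div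

section Translation

variable {Γ : Type*} [AddCommGroup Γ] [LinearOrder Γ] [IsOrderedAddMonoid Γ]
  {F : Type*} [Field F] (v : AddValuation F (WithTop Γ)) {α β : Type*}

theorem exists_polynomial_of_term (t : valuedFieldLang.Term β) :
    letI := valuedFieldStructure v
    ∃ P : MvPolynomial β F, ∀ z : β → F, t.realize z = MvPolynomial.eval z P := by
  let := valuedFieldStructure v
  induction t with
  | var i => exact ⟨MvPolynomial.X i, fun z => by simp⟩
  | func f ts ih =>
    choose P hP using ih
    cases f with
    | add =>
      refine ⟨P 0 + P 1, fun z => ?_⟩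
      rw [map_add, ← hP, ← hP]
      rfl
    | mul =>
      refine ⟨P 0 * P 1, fun z => ?_⟩
      rw [map_mul, ← hP, ← hP]
      rfl
    | neg =>
      refine ⟨-P 0, fun z => ?_⟩
      rw [map_neg, ← hP]
      rfl
    | zero =>
      refine ⟨0, fun z => ?_⟩
      rw [map_zero]
      rfl
    | one =>
      refine ⟨1, fun z => ?_⟩
      rw [map_one]
      rfl

theorem exists_term_of_polynomial (P : MvPolynomial α F) :
    letI := valuedFieldStructure v
    ∃ t : valuedFieldLang.Term (F ⊕ α), ∀ y : α → F,
      t.realize (Sum.elim id y) = MvPolynomial.eval y P := by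
  let := valuedFieldStructure v
  induction P using MvPolynomial.induction_on with
  | C a => exact ⟨Term.var (Sum.inl a), fun y => by simp⟩
  | add p q hp hq =>
    obtain ⟨t, ht⟩ := hp
    obtain ⟨s, hs⟩ := hq
    refine ⟨fieldAdd.apply₂ t s, fun y => ?_⟩
    rw [Term.realize_functions_apply₂, ht, hs, map_add]
    rfl
  | mul_X p i hp =>
    obtain ⟨t, ht⟩ := hp
    refine ⟨fieldMul.apply₂ t (Term.var (Sum.inr i)),
      fun y => ?_⟩
    rw [Term.realize_functions_apply₂, ht, map_mul, MvPolynomial.eval_X]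
    rfl

theorem QF.exists_formula {E : Set (α → F)} (h : QF v E) :
    letI := valuedFieldStructure v
    ∃ φ : valuedFieldLang.Formula (F ⊕ α), ∀ y : α → F, φ.Realize (Sum.elim id y) ↔ y ∈ E := by
  let := valuedFieldStructure v
  induction h with
  | basic P Q =>
    obtain ⟨t, ht⟩ := exists_term_of_polynomial v P
    obtain ⟨s, hs⟩ := exists_term_of_polynomial v Q
    refine ⟨fieldDiv.formula₂ t s, fun y => ?_⟩
    rw [Formula.realize_rel₂, ht, hs]
    rfl
  | compl _ ih =>
    obtain ⟨φ, hφ⟩ := ih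
    exact ⟨φ.not, fun y => by rw [Formula.realize_not, hφ]; rfl⟩
  | inter _ _ ih ih' =>
    obtain ⟨φ, hφ⟩ := ih
    obtain ⟨ψ, hψ⟩ := ih'
    exact ⟨φ ⊓ ψ, fun y => by rw [Formula.realize_inf, hφ, hψ]; rfl⟩

/-- A formula whose free variables include the elements of a structure gives a formula with
parameters. -/
theorem exists_formula_withConstants {𝓛 : Language} {M : Type*} [𝓛.Structure M]
    (φ : 𝓛.Formula (M ⊕ α)) :
    ∃ δ : 𝓛[[M]].Formula α, ∀ b : α → M, δ.Realize b ↔ φ.Realize (Sum.elim id b) := by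
  refine ⟨BoundedFormula.constantsVarsEquiv.symm φ, fun b => ?_⟩
  have := BoundedFormula.realize_constantsVarsEquiv (M := M)
    (φ := BoundedFormula.constantsVarsEquiv.symm φ) (v := b) (xs := default)
  rw [Equiv.apply_symm_apply] at this
  exact this.symm

theorem exists_formula_of_withConstants {𝓛 : Language} {M : Type*} [𝓛.Structure M]
    (δ : 𝓛[[M]].Formula α) :
    ∃ φ : 𝓛.Formula (M ⊕ α), ∀ b : α → M, δ.Realize b ↔ φ.Realize (Sum.elim id b) := by
  refine ⟨BoundedFormula.constantsVarsEquiv δ, fun b => ?_⟩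
  exact (BoundedFormula.realize_constantsVarsEquiv (M := M) (φ := δ) (v := b)
    (xs := default)).symm

variable {v}

theorem QF.forall_last [IsAlgClosed F] (hv : ∃ t : F, t ≠ 0 ∧ v t ≠ 0) {n : ℕ}
    {E : Set (α ⊕ Fin (n + 1) → F)} (hE : QF v E) :
    QF v {z : α ⊕ Fin n → F |
      ∀ x, Sum.elim (z ∘ Sum.inl) (Fin.snoc (α := fun _ => F) (z ∘ Sum.inr) x) ∈ E} := by
  let g : α ⊕ Fin (n + 1) → Option (α ⊕ Fin n) :=
    Sum.elim (fun a => some (Sum.inl a))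
      (Fin.snoc (α := fun _ => Option (α ⊕ Fin n)) (fun i => some (Sum.inr i)) none)
  have h := (QF.projection hv (hE.compl.reindex g)).compl
  convert h using 1
  ext z
  simp only [Set.mem_ofPred_eq, Set.mem_compl_iff, not_exists, not_not]
  refine forall_congr' fun x => ?_
  have : (fun o : Option (α ⊕ Fin n) => o.elim x z) ∘ g =
      Sum.elim (z ∘ Sum.inl) (Fin.snoc (α := fun _ => F) (z ∘ Sum.inr) x) := by
    funext i
    rcases i with a | i
    · rfl
    · refine Fin.lastCases ?_ (fun i => ?_) i
      · simp [g]
      · simp [g]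
  rw [this]

/-- Quantifier elimination for algebraically closed valued fields. -/
theorem QF.of_boundedFormula [IsAlgClosed F] (hv : ∃ t : F, t ≠ 0 ∧ v t ≠ 0) {n : ℕ}
    (φ : valuedFieldLang.BoundedFormula α n) :
    letI := valuedFieldStructure v
    QF v {z : α ⊕ Fin n → F | φ.Realize (z ∘ Sum.inl) (z ∘ Sum.inr)} := by
  let := valuedFieldStructure v
  have hz : ∀ {n} (z : α ⊕ Fin n → F), Sum.elim (z ∘ Sum.inl) (z ∘ Sum.inr) = z := fun z =>
    Sum.elim_comp_inl_inr z
  induction φ with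
  | falsum => exact QF.empty
  | equal t₁ t₂ =>
    obtain ⟨P, hP⟩ := exists_polynomial_of_term v t₁
    obtain ⟨Q, hQ⟩ := exists_polynomial_of_term v t₂
    convert QF.eq_zero (v := v) (P - Q) using 1
    ext z
    simp only [Set.mem_ofPred_eq, BoundedFormula.Realize, hz, hP, hQ, map_sub, sub_eq_zero]
  | rel R ts =>
    choose P hP using fun i => exists_polynomial_of_term v (ts i)
    cases R with
    | div =>
      convert QF.basic (v := v) (P 0) (P 1) using 1
      ext z
      simp only [Set.mem_ofPred_eq, BoundedFormula.Realize, hz, hP]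
      rfl
  | imp φ ψ ih ih' =>
    convert ih.compl.union ih' using 1
    ext z
    simp only [Set.mem_ofPred_eq, BoundedFormula.realize_imp, Set.mem_union, Set.mem_compl_iff]
    exact imp_iff_not_or
  | all φ ih =>
    convert QF.forall_last hv ih using 1
    ext z
    simp only [Set.mem_ofPred_eq, BoundedFormula.realize_all]
    rfl

theorem QF.of_formula [IsAlgClosed F] (hv : ∃ t : F, t ≠ 0 ∧ v t ≠ 0)
    (φ : valuedFieldLang.Formula α) :
    letI := valuedFieldStructure v
    QF v {z : α → F | φ.Realize z} := by
  let := valuedFieldStructure v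
  have h := (QF.of_boundedFormula hv φ).preimage (β := α)
    (Sum.elim (fun a => MvPolynomial.X a) fun i => i.elim0)
  convert h using 1
  ext z
  simp only [Set.mem_ofPred_eq, Formula.Realize]
  refine iff_of_eq (congrArg₂ _ ?_ (Subsingleton.elim _ _))
  funext a
  simp

/-- Specializing some of the variables of a quantifier free definable set. -/
theorem QF.specialize {E : Set (β ⊕ α → F)} (h : QF v E) (a : β → F) :
    QF v {y : α → F | Sum.elim a y ∈ E} := by
  convert h.preimage (β := α) (Sum.elim (fun b => MvPolynomial.C (a b)) fun i => MvPolynomial.X i)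
    using 1
  ext y
  simp only [Set.mem_ofPred_eq]
  refine iff_of_eq (congrArg (· ∈ E) ?_)
  funext i
  cases i <;> simp

theorem QF.of_formula_withConstants [IsAlgClosed F] (hv : ∃ t : F, t ≠ 0 ∧ v t ≠ 0) :
    letI := valuedFieldStructure v
    ∀ δ : valuedFieldLang[[F]].Formula α, QF v {z : α → F | δ.Realize z} := by
  let := valuedFieldStructure v
  intro δ
  obtain ⟨φ, hφ⟩ := exists_formula_of_withConstants δ
  simp only [hφ]
  exact (QF.of_formula hv φ).specialize id

/-! ### The value group -/

open Classical in
/-- The value of a nonzero element in the value group, extended by `0`. -/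
noncomputable def valG (v : AddValuation F (WithTop Γ)) (x : F) : valueGroup v :=
  if h : x = 0 then 0 else
    ⟨(v x).untop ((v.ne_top_iff).2 h), x, (WithTop.coe_untop _ _).symm⟩

theorem coe_valG {x : F} (hx : x ≠ 0) : ((valG v x : Γ) : WithTop Γ) = v x := by
  rw [valG, dif_neg hx]
  exact WithTop.coe_untop _ _

theorem exists_valG_eq (g : valueGroup v) : ∃ x : F, x ≠ 0 ∧ valG v x = g := by
  obtain ⟨γ, x, hx⟩ := g
  have hx0 : x ≠ 0 := by
    rintro rfl
    rw [v.map_zero] at hx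
    exact WithTop.top_ne_coe hx
  refine ⟨x, hx0, Subtype.ext ?_⟩
  rw [← WithTop.coe_inj, coe_valG hx0, hx]

theorem valG_le_valG {x y : F} (hx : x ≠ 0) (hy : y ≠ 0) : valG v x ≤ valG v y ↔ v x ≤ v y := by
  rw [← coe_valG hx, ← coe_valG hy, WithTop.coe_le_coe]
  rfl

theorem valG_eq_valG {x y : F} (hx : x ≠ 0) (hy : y ≠ 0) : valG v x = valG v y ↔ v x = v y := by
  rw [← coe_valG hx, ← coe_valG hy, WithTop.coe_inj]
  exact Subtype.ext_iff

theorem valG_mul {x y : F} (hx : x ≠ 0) (hy : y ≠ 0) :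
    valG v (x * y) = valG v x + valG v y := by
  apply Subtype.ext
  rw [← WithTop.coe_inj, coe_valG (mul_ne_zero hx hy), v.map_mul, AddSubgroup.coe_add,
    WithTop.coe_add, coe_valG hx, coe_valG hy]

theorem valG_one : valG v 1 = 0 := by
  have := valG_mul (v := v) (one_ne_zero (α := F)) one_ne_zero
  rw [mul_one] at this
  simpa using this

theorem valG_inv {x : F} (hx : x ≠ 0) : valG v x⁻¹ = -valG v x := by
  rw [eq_neg_iff_add_eq_zero, ← valG_mul (inv_ne_zero hx) hx, inv_mul_cancel₀ hx, valG_one]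

/-- Sums and negatives in the value group lift to products and inverses. A fraction is kept because
polynomials have no inverse. -/
theorem exists_fraction_of_term (t : orderedGroupLang.Term β) :
    ∃ P Q : MvPolynomial β F, ∀ z : β → F, (∀ i, z i ≠ 0) →
      MvPolynomial.eval z P ≠ 0 ∧ MvPolynomial.eval z Q ≠ 0 ∧
        t.realize (fun i => valG v (z i)) =
          valG v (MvPolynomial.eval z P / MvPolynomial.eval z Q) := by
  induction t with
  | var i => exact ⟨MvPolynomial.X i, 1, fun z hz => by simpa using hz i⟩
  | func f ts ih =>
    choose P Q hPQ using ih
    cases f with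
    | add =>
      refine ⟨P 0 * P 1, Q 0 * Q 1, fun z hz => ?_⟩
      obtain ⟨h1, h2, h3⟩ := hPQ 0 z hz
      obtain ⟨h4, h5, h6⟩ := hPQ 1 z hz
      rw [map_mul, map_mul]
      refine ⟨mul_ne_zero h1 h4, mul_ne_zero h2 h5, ?_⟩
      rw [mul_div_mul_comm, valG_mul (div_ne_zero h1 h2) (div_ne_zero h4 h5), ← h3, ← h6]
      rfl
    | neg =>
      refine ⟨Q 0, P 0, fun z hz => ?_⟩
      obtain ⟨h1, h2, h3⟩ := hPQ 0 z hz
      refine ⟨h2, h1, ?_⟩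
      rw [← inv_div, valG_inv (div_ne_zero h1 h2), ← h3]
      rfl
    | zero =>
      refine ⟨1, 1, fun z hz => ?_⟩
      rw [map_one, div_one, valG_one]
      exact ⟨one_ne_zero, one_ne_zero, rfl⟩

theorem valG_div_le_valG_div {a b c d : F} (ha : a ≠ 0) (hb : b ≠ 0) (hc : c ≠ 0) (hd : d ≠ 0) :
    valG v (a / b) ≤ valG v (c / d) ↔ v (a * d) ≤ v (c * b) := by
  rw [← valG_le_valG (mul_ne_zero ha hd) (mul_ne_zero hc hb), div_eq_mul_inv, div_eq_mul_inv,
    valG_mul ha (inv_ne_zero hb), valG_mul hc (inv_ne_zero hd), valG_inv hb, valG_inv hd,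
    valG_mul ha hd, valG_mul hc hb, ← sub_eq_add_neg, ← sub_eq_add_neg, sub_le_sub_iff]

/-- The value group is interpreted in the valued field by quantifier free formulas. -/
theorem QF.of_orderedGroup_boundedFormula [IsAlgClosed F] (hv : ∃ t : F, t ≠ 0 ∧ v t ≠ 0) {n : ℕ}
    (φ : orderedGroupLang.BoundedFormula α n) :
    ∃ E : Set (α ⊕ Fin n → F), QF v E ∧ ∀ z : α ⊕ Fin n → F, (∀ i, z i ≠ 0) →
      (z ∈ E ↔ φ.Realize (fun i => valG v (z (Sum.inl i))) fun i => valG v (z (Sum.inr i))) := by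
  have hz : ∀ {n} (z : α ⊕ Fin n → F),
      Sum.elim (fun i => valG v (z (Sum.inl i))) (fun i => valG v (z (Sum.inr i))) =
        fun i => valG v (z i) := fun z => by
    funext i
    cases i <;> rfl
  induction φ with
  | falsum => exact ⟨∅, QF.empty, fun z _ => Iff.rfl⟩
  | equal t₁ t₂ =>
    obtain ⟨P, Q, hPQ⟩ := exists_fraction_of_term (v := v) t₁
    obtain ⟨P', Q', hPQ'⟩ := exists_fraction_of_term (v := v) t₂
    refine ⟨_, (QF.basic (P * Q') (P' * Q)).inter (QF.basic (P' * Q) (P * Q')), fun z h => ?_⟩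
    obtain ⟨h1, h2, h3⟩ := hPQ z h
    obtain ⟨h4, h5, h6⟩ := hPQ' z h
    simp only [BoundedFormula.Realize, hz, h3, h6]
    rw [le_antisymm_iff, valG_div_le_valG_div h1 h2 h4 h5, valG_div_le_valG_div h4 h5 h1 h2]
    simp only [Set.mem_inter_iff, Set.mem_ofPred_eq, map_mul]
  | rel R ts =>
    choose P Q hPQ using fun i => exists_fraction_of_term (v := v) (ts i)
    cases R with
    | le =>
      refine ⟨_, QF.basic (P 0 * Q 1) (P 1 * Q 0), fun z h => ?_⟩
      obtain ⟨h1, h2, h3⟩ := hPQ 0 z h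
      obtain ⟨h4, h5, h6⟩ := hPQ 1 z h
      have hR : (BoundedFormula.rel (L := orderedGroupLang) OAGRel.le ts).Realize
          (fun i => valG v (z (Sum.inl i))) (fun i => valG v (z (Sum.inr i))) ↔
          (ts 0).realize (fun i => valG v (z i)) ≤ (ts 1).realize (fun i => valG v (z i)) := by
        simp only [BoundedFormula.Realize, hz]
        rfl
      rw [hR, h3, h6, valG_div_le_valG_div h1 h2 h4 h5]
      simp only [Set.mem_ofPred_eq, map_mul]
  | imp φ ψ ih ih' =>
    obtain ⟨E, hE, h⟩ := ih
    obtain ⟨E', hE', h'⟩ := ih'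
    refine ⟨_, hE.compl.union hE', fun z hz => ?_⟩
    rw [BoundedFormula.realize_imp, ← h z hz, ← h' z hz]
    exact imp_iff_not_or.symm
  | @all n φ ih =>
    obtain ⟨E, hE, h⟩ := ih
    -- The alternative `x = 0` restricts the field quantifier to nonzero elements, which are exactly
    -- the lifts of values.
    refine ⟨_, QF.forall_last hv
      ((QF.eq_zero (v := v) (MvPolynomial.X (Sum.inr (Fin.last n)))).union hE), fun z hz => ?_⟩
    have hkey : ∀ x : F, x ≠ 0 →
        (Sum.elim (z ∘ Sum.inl) (Fin.snoc (α := fun _ => F) (z ∘ Sum.inr) x) ∈ E ↔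
          φ.Realize (fun i => valG v (z (Sum.inl i)))
            (Fin.snoc (α := fun _ => valueGroup v) (fun i => valG v (z (Sum.inr i)))
              (valG v x))) := by
      intro x hx
      rw [h]
      · refine iff_of_eq (congrArg₂ _ rfl ?_)
        funext i
        refine Fin.lastCases ?_ (fun i => ?_) i <;> simp
      · intro i
        rcases i with i | i
        · exact hz _
        · refine Fin.lastCases ?_ (fun i => ?_) i
          · simpa using hx
          · simpa using hz _
    simp only [Set.mem_ofPred_eq, Set.mem_union, MvPolynomial.eval_X, Sum.elim_inr, Fin.snoc_last,
      BoundedFormula.realize_all]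
    constructor
    · intro H g
      obtain ⟨x, hx, rfl⟩ := exists_valG_eq g
      exact (hkey x hx).1 ((H x).resolve_left hx)
    · intro H x
      by_cases hx : x = 0
      · exact Or.inl hx
      · exact Or.inr ((hkey x hx).2 (H _))

theorem QF.of_orderedGroup_formula [IsAlgClosed F] (hv : ∃ t : F, t ≠ 0 ∧ v t ≠ 0)
    (φ : orderedGroupLang.Formula α) :
    ∃ E : Set (α → F), QF v E ∧ ∀ z : α → F, (∀ i, z i ≠ 0) →
      (z ∈ E ↔ φ.Realize fun i => valG v (z i)) := by
  obtain ⟨E, hE, h⟩ := QF.of_orderedGroup_boundedFormula hv φ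
  refine ⟨_, hE.preimage (β := α) (Sum.elim (fun a => MvPolynomial.X a) fun i => i.elim0),
    fun z hz => ?_⟩
  have hz' : ∀ i : α ⊕ Fin 0, MvPolynomial.eval z
      (Sum.elim (fun a => MvPolynomial.X a) (fun i => i.elim0) i) ≠ 0 := by
    intro i
    rcases i with i | i
    · simpa using hz i
    · exact i.elim0
  refine (h _ hz').trans (iff_of_eq (congrArg₂ _ ?_ (Subsingleton.elim _ _)))
  funext i
  simp

end Translation

end DefinableTypes

/-! ### Generic lifts of tuples of values -/

namespace DefinableTypes

open FirstOrder FirstOrder.Language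

section Generic

variable {Γ : Type*} [AddCommGroup Γ] [LinearOrder Γ] [IsOrderedAddMonoid Γ]
  {F : Type*} [Field F] (v : AddValuation F (WithTop Γ)) {α : Type*}

/-- The valuation ring of an additive valuation. -/
def valRing : ValuationSubring F where
  carrier := {x | 0 ≤ v x}
  mul_mem' := fun {a b} ha hb => by
    change 0 ≤ v (a * b)
    rw [v.map_mul]
    exact add_nonneg ha hb
  one_mem' := v.map_one.ge
  add_mem' := fun {a b} ha hb => v.map_le_add ha hb
  zero_mem' := by simp
  neg_mem' := fun {a} ha => by
    change 0 ≤ v (-a)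
    rw [v.map_neg]
    exact ha
  mem_or_inv_mem' := val_nonneg_or_inv v

theorem valRing_one_le_valuation (x : F) : 1 ≤ (valRing v).valuation x ↔ v x ≤ 0 := by
  by_cases hx : x = 0
  · simp [hx]
  · rw [← not_lt, ← ValuationSubring.mem_nonunits_iff, ValuationSubring.mem_nonunits_iff_or]
    have h1 : x⁻¹ ∈ valRing v ↔ 0 ≤ v x⁻¹ := Iff.rfl
    rw [h1]
    have h2 := val_nonneg_div_iff v (x := 1) hx
    rw [v.map_one, one_div] at h2
    rw [h2]
    simp [hx]

/-- Otherwise there would be a generic unit at distance 1 from representatives of all residue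
classes, including its own. -/
theorem residueField_infinite [IsAlgClosed F] :
    Infinite (IsLocalRing.ResidueField (valRing v)) := by
  classical
  by_contra hfin
  rw [not_infinite_iff_finite] at hfin
  cases nonempty_fintype (IsLocalRing.ResidueField (valRing v))
  choose r hr using IsLocalRing.residue_surjective (R := valRing v)
  obtain ⟨u, hu, hS⟩ := exists_generic_unit (valRing v).valuation
    (Finset.univ.image fun x => ((r x : valRing v) : F))
  have hu' : u ∈ valRing v := ((valRing v).valuation_le_one_iff u).1 hu.le
  set x := IsLocalRing.residue (valRing v) ⟨u, hu'⟩ with hx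
  have h1 := hS _ (Finset.mem_image_of_mem _ (Finset.mem_univ x))
  have h2 : (⟨u, hu'⟩ - r x : valRing v) ∈ IsLocalRing.maximalIdeal (valRing v) := by
    rw [← IsLocalRing.residue_eq_zero_iff, map_sub, hr, hx, sub_self]
  rw [ValuationSubring.valuation_lt_one_iff] at h2
  exact absurd h2 (not_lt.2 h1)

/-- The minimum of the values at `y` of the monomials of `P`. -/
noncomputable def tropEval (y : α → F) (P : MvPolynomial α F) : WithTop Γ :=
  P.support.inf fun I => v (MvPolynomial.eval y (MvPolynomial.monomial I (P.coeff I)))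

variable {v}

theorem eval_monomial_ne_zero {y : α → F} (hy : ∀ i, y i ≠ 0) (I : α →₀ ℕ) {a : F} (ha : a ≠ 0) :
    MvPolynomial.eval y (MvPolynomial.monomial I a) ≠ 0 := by
  rw [MvPolynomial.eval_monomial]
  exact mul_ne_zero ha (Finsupp.prod_ne_zero_iff.2 fun i _ => pow_ne_zero _ (hy i))

/-- Put `y = u * y₀` coordinatewise with units `u`. Dividing `P` by its dominant monomial at `y₀`
gives an integral polynomial in `u` with a coefficient 1, hence with nonzero reduction. Since the
residue field is infinite, the residues of `u` can avoid the zeros of all these reductions. -/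
theorem exists_generic_lift [IsAlgClosed F] [Finite α] (S : Finset (MvPolynomial α F))
    {y₀ : α → F} (hy₀ : ∀ i, y₀ i ≠ 0) :
    ∃ y : α → F, (∀ i, y i ≠ 0) ∧ (∀ i, v (y i) = v (y₀ i)) ∧
      ∀ P ∈ S, v (MvPolynomial.eval y P) = tropEval v y P := by
  classical
  cases nonempty_fintype α
  have := residueField_infinite v
  let O := valRing v
  let k := IsLocalRing.ResidueField O
  -- a polynomial with integral coefficients for each nonzero element of `S`
  have hint : ∀ P : MvPolynomial α F, ∃ Q : MvPolynomial α O,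
      MvPolynomial.map (IsLocalRing.residue O) Q ≠ 0 ∧ ∀ u : α → O,
        IsLocalRing.residue O (MvPolynomial.eval u Q) ≠ 0 → (∀ i, v (u i : F) = 0) →
        v (MvPolynomial.eval (fun i => u i * y₀ i) P) =
          tropEval v (fun i => u i * y₀ i) P := by
    intro P
    by_cases hP : P = 0
    · exact ⟨1, by simp, fun u _ _ => by simp [hP, tropEval]⟩
    let m : (α →₀ ℕ) → F := fun I =>
      MvPolynomial.eval y₀ (MvPolynomial.monomial I (P.coeff I))
    obtain ⟨J, hJ, hJmin⟩ := Finset.exists_min_image P.support (fun I => v (m I))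
      (MvPolynomial.support_nonempty.2 hP)
    have hmJ : m J ≠ 0 := eval_monomial_ne_zero hy₀ J (MvPolynomial.mem_support_iff.1 hJ)
    have hle : ∀ I, v (m J) ≤ v (m I) := fun I => by
      by_cases hI : I ∈ P.support
      · exact hJmin I hI
      · have : m I = 0 := by simp [m, MvPolynomial.notMem_support_iff.1 hI]
        rw [this, v.map_zero]
        exact le_top
    let c : (α →₀ ℕ) → O := fun I => ⟨m I / m J, (val_nonneg_div_iff v hmJ).2 (hle I)⟩
    let Q : MvPolynomial α O := ∑ I ∈ P.support, MvPolynomial.monomial I (c I)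
    have hcoeff : Q.coeff J = 1 := by
      simp only [Q, MvPolynomial.coeff_sum, MvPolynomial.coeff_monomial, Finset.sum_ite_eq', hJ,
        if_true]
      exact Subtype.ext (div_self hmJ)
    refine ⟨Q, fun h0 => ?_, fun u hu hu0 => ?_⟩
    · have := congrArg (MvPolynomial.coeff J) h0
      rw [MvPolynomial.coeff_map, hcoeff, map_one, MvPolynomial.coeff_zero] at this
      exact one_ne_zero this
    · have hmon : ∀ I a, MvPolynomial.eval (fun i => u i * y₀ i) (MvPolynomial.monomial I a) =
          MvPolynomial.eval y₀ (MvPolynomial.monomial I a) * ∏ i, (u i : F) ^ I i := by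
        intro I a
        rw [MvPolynomial.eval_monomial, MvPolynomial.eval_monomial,
          Finsupp.prod_fintype _ _ (fun i => pow_zero _),
          Finsupp.prod_fintype _ _ (fun i => pow_zero _)]
        simp only [mul_pow, Finset.prod_mul_distrib]
        ring
      have hprod0 : ∀ I : α →₀ ℕ, v (∏ i, (u i : F) ^ I i) = 0 := by
        intro I
        refine Finset.prod_induction (fun i => (u i : F) ^ I i) (fun x => v x = 0)
          (fun a b ha hb => by rw [v.map_mul, ha, hb, add_zero]) v.map_one fun i _ => ?_
        rw [v.map_pow, hu0, smul_zero]
      have hevalP : MvPolynomial.eval (fun i => u i * y₀ i) P =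
          m J * ((MvPolynomial.eval u Q : O) : F) := by
        conv_lhs => rw [MvPolynomial.as_sum P]
        simp only [Q, map_sum]
        rw [AddSubmonoidClass.coe_finsetSum, Finset.mul_sum]
        refine Finset.sum_congr rfl fun I _ => ?_
        rw [hmon, MvPolynomial.eval_monomial (a := c I),
          Finsupp.prod_fintype _ _ (fun i => pow_zero _)]
        simp only [c, MulMemClass.coe_mul, SubmonoidClass.coe_finsetProd, SubmonoidClass.coe_pow]
        rw [← mul_assoc, mul_div_cancel₀ _ hmJ]
      have hQ0 : v ((MvPolynomial.eval u Q : O) : F) = 0 := by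
        refine le_antisymm ?_ (MvPolynomial.eval u Q : O).2
        rw [← valRing_one_le_valuation, ← not_lt]
        intro hlt
        exact hu ((IsLocalRing.residue_eq_zero_iff _).2
          ((ValuationSubring.valuation_lt_one_iff _ _).2 hlt))
      rw [hevalP, v.map_mul, hQ0, add_zero, tropEval]
      refine le_antisymm (Finset.le_inf fun I hI => ?_) ?_
      · rw [hmon, v.map_mul, hprod0, add_zero]
        exact hle I
      · refine (Finset.inf_le hJ).trans ?_
        rw [hmon, v.map_mul, hprod0, add_zero]
  choose Q hQ hQeval using hint
  -- The factor `∏ i, X i` makes every residue nonzero, so that the lifts are units.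
  obtain ⟨x, hx⟩ : ∃ x : α → k, MvPolynomial.eval x ((∏ P ∈ S,
      MvPolynomial.map (IsLocalRing.residue O) (Q P)) * ∏ i, MvPolynomial.X i) ≠ 0 := by
    by_contra hcon
    push Not at hcon
    have h0 : (∏ P ∈ S, MvPolynomial.map (IsLocalRing.residue O) (Q P)) *
        ∏ i : α, MvPolynomial.X i = (0 : MvPolynomial α k) :=
      MvPolynomial.funext fun x => by rw [hcon, map_zero]
    rcases mul_eq_zero.1 h0 with h | h
    · obtain ⟨P, -, hP⟩ := Finset.prod_eq_zero_iff.1 h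
      exact hQ P hP
    · obtain ⟨i, -, hi⟩ := Finset.prod_eq_zero_iff.1 h
      exact MvPolynomial.X_ne_zero i hi
  rw [map_mul, map_prod, map_prod] at hx
  have hx1 : ∀ P ∈ S, MvPolynomial.eval x (MvPolynomial.map (IsLocalRing.residue O) (Q P)) ≠ 0 :=
    Finset.prod_ne_zero_iff.1 (left_ne_zero_of_mul hx)
  have hx2 : ∀ i, x i ≠ 0 := fun i => by
    simpa using Finset.prod_ne_zero_iff.1 (right_ne_zero_of_mul hx) i (Finset.mem_univ i)
  choose u hu using fun i => IsLocalRing.residue_surjective (R := O) (x i)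
  have hu0 : ∀ i, v (u i : F) = 0 := fun i => by
    refine le_antisymm ?_ (u i).2
    rw [← valRing_one_le_valuation, ← not_lt]
    intro hlt
    apply hx2 i
    rw [← hu]
    exact (IsLocalRing.residue_eq_zero_iff _).2 ((ValuationSubring.valuation_lt_one_iff _ _).2 hlt)
  have hune : ∀ i, (u i : F) ≠ 0 := fun i h => by
    have := hu0 i
    rw [h, v.map_zero] at this
    exact WithTop.top_ne_coe this
  refine ⟨fun i => u i * y₀ i, fun i => mul_ne_zero (hune i) (hy₀ i), fun i => ?_, fun P hP => ?_⟩
  · rw [v.map_mul, hu0, zero_add]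
  · refine hQeval P u ?_ hu0
    have := hx1 P hP
    rw [MvPolynomial.eval_map, ← funext hu] at this
    rw [← MvPolynomial.eval₂_id, MvPolynomial.hom_eval₂]
    exact this

/-- The addition symbol of ordered groups. -/
abbrev groupAdd : orderedGroupLang.Functions 2 := OAGFunc.add

/-- The order symbol of ordered groups. -/
abbrev groupLe : orderedGroupLang.Relations 2 := OAGRel.le

theorem exists_group_term (I : α →₀ ℕ) {a : F} (ha : a ≠ 0) :
    ∃ t : orderedGroupLang.Term (valueGroup v ⊕ α), ∀ y : α → F, (∀ i, y i ≠ 0) →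
      t.realize (Sum.elim id fun i => valG v (y i)) =
        valG v (MvPolynomial.eval y (MvPolynomial.monomial I a)) := by
  classical
  induction I using Finsupp.induction with
  | zero => exact ⟨Term.var (Sum.inl (valG v a)), fun y _ => by simp⟩
  | single_add i n I _ _ ih =>
    obtain ⟨t, ht⟩ := ih
    have hn : ∀ n : ℕ, ∃ t : orderedGroupLang.Term (valueGroup v ⊕ α), ∀ y : α → F,
        (∀ i, y i ≠ 0) → t.realize (Sum.elim id fun i => valG v (y i)) = valG v (y i ^ n) := by
      intro n
      induction n with
      | zero => exact ⟨Term.var (Sum.inl 0), fun y _ => by simp [valG_one]⟩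
      | succ n ih =>
        obtain ⟨s, hs⟩ := ih
        refine ⟨groupAdd.apply₂ s (Term.var (Sum.inr i)), fun y hy => ?_⟩
        rw [Term.realize_functions_apply₂, hs y hy, pow_succ, valG_mul (pow_ne_zero _ (hy i)) (hy i)]
        rfl
    obtain ⟨s, hs⟩ := hn n
    refine ⟨groupAdd.apply₂ s t, fun y hy => ?_⟩
    have h1 : MvPolynomial.eval y (MvPolynomial.monomial (Finsupp.single i n + I) a) =
        y i ^ n * MvPolynomial.eval y (MvPolynomial.monomial I a) := by
      rw [← one_mul a, ← MvPolynomial.monomial_mul, map_mul, MvPolynomial.eval_monomial, one_mul,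
        one_mul]
      simp
    rw [Term.realize_functions_apply₂, hs y hy, ht y hy, h1,
      valG_mul (pow_ne_zero _ (hy i)) (eval_monomial_ne_zero hy I ha)]
    rfl

/-- On tuples where finitely many polynomials take their generic value, a quantifier free
definable set is the pullback of a definable set of the value group. -/
theorem QF.exists_group_formula {E : Set (α → F)} (h : QF v E) :
    ∃ (S : Finset (MvPolynomial α F)) (ψ : orderedGroupLang.Formula (valueGroup v ⊕ α)),
      ∀ y : α → F, (∀ i, y i ≠ 0) → (∀ P ∈ S, v (MvPolynomial.eval y P) = tropEval v y P) →
        (ψ.Realize (Sum.elim id fun i => valG v (y i)) ↔ y ∈ E) := by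
  classical
  induction h with
  | basic P Q =>
    choose t ht using fun I : P.support =>
      exists_group_term (v := v) I.1 (MvPolynomial.mem_support_iff.1 I.2)
    choose s hs using fun J : Q.support =>
      exists_group_term (v := v) J.1 (MvPolynomial.mem_support_iff.1 J.2)
    refine ⟨{P, Q}, BoundedFormula.iInf fun J => BoundedFormula.iSup fun I =>
      groupLe.formula₂ (t I) (s J), fun y hy hgen => ?_⟩
    have hP := hgen P (by simp)
    have hQ := hgen Q (by simp)
    have hat : ∀ I J, (groupLe.formula₂ (t I) (s J)).Realize (Sum.elim id fun i => valG v (y i)) ↔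
        v (MvPolynomial.eval y (MvPolynomial.monomial I.1 (P.coeff I.1))) ≤
          v (MvPolynomial.eval y (MvPolynomial.monomial J.1 (Q.coeff J.1))) := by
      intro I J
      rw [Formula.realize_rel₂, ht I y hy, hs J y hy, ← valG_le_valG
        (eval_monomial_ne_zero hy _ (MvPolynomial.mem_support_iff.1 I.2))
        (eval_monomial_ne_zero hy _ (MvPolynomial.mem_support_iff.1 J.2))]
      rfl
    have hiff : Formula.Realize (BoundedFormula.iInf fun J => BoundedFormula.iSup fun I =>
        groupLe.formula₂ (t I) (s J)) (Sum.elim id fun i => valG v (y i)) ↔ ∀ J, ∃ I,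
          (groupLe.formula₂ (t I) (s J)).Realize (Sum.elim id fun i => valG v (y i)) := by
      rw [Formula.Realize, BoundedFormula.realize_iInf]
      simp only [BoundedFormula.realize_iSup]
      rfl
    rw [hiff]
    simp only [hat, Set.mem_ofPred_eq, hP, hQ]
    constructor
    · intro H
      refine Finset.le_inf fun J hJ => ?_
      obtain ⟨I, hI⟩ := H ⟨J, hJ⟩
      exact (Finset.inf_le I.2).trans hI
    · intro H J
      have h1 : tropEval v y P ≤ v (MvPolynomial.eval y (MvPolynomial.monomial J.1 (Q.coeff J.1))) :=
        H.trans (Finset.inf_le J.2)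
      -- A nonzero monomial of `Q` has finite value, so the minimum over `P` is finite and is
      -- attained by some monomial.
      have hne : P.support.Nonempty := by
        rw [Finset.nonempty_iff_ne_empty]
        intro h0
        rw [tropEval, h0, Finset.inf_empty, top_le_iff, v.top_iff] at h1
        exact eval_monomial_ne_zero hy _ (MvPolynomial.mem_support_iff.1 J.2) h1
      obtain ⟨I, hI, hIeq⟩ := Finset.exists_mem_eq_inf P.support hne fun I =>
        v (MvPolynomial.eval y (MvPolynomial.monomial I (P.coeff I)))
      exact ⟨⟨I, hI⟩, hIeq ▸ h1⟩
  | compl _ ih =>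
    obtain ⟨S, φ, hφ⟩ := ih
    exact ⟨S, φ.not, fun y hy hS => by rw [Formula.realize_not, hφ y hy hS]; rfl⟩
  | inter _ _ ih ih' =>
    obtain ⟨S, φ, hφ⟩ := ih
    obtain ⟨S', ψ, hψ⟩ := ih'
    refine ⟨S ∪ S', φ ⊓ ψ, fun y hy hS => ?_⟩
    rw [Formula.realize_inf, hφ y hy fun P hP => hS P (Finset.mem_union_left _ hP),
      hψ y hy fun P hP => hS P (Finset.mem_union_right _ hP)]
    rfl

end Generic

end DefinableTypes

/-! ### Definability of traces on the subfield -/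

namespace DefinableTypes

open FirstOrder FirstOrder.Language

section Trace

variable {Γ : Type*} [AddCommGroup Γ] [LinearOrder Γ] [IsOrderedAddMonoid Γ]
  {L : Type*} [Field L] {v : AddValuation L (WithTop Γ)} {K : Subfield L} {α : Type*}

/-- The dummy parameter `m₀` keeps the parameter tuple nonempty, as definability of types is only
given for lengths at least 1. -/
theorem exists_finite_parameters {𝓛 : Language} {M : Type*} [Nonempty M] [𝓛.Structure M]
    (φ : 𝓛.Formula (M ⊕ α)) :
    ∃ (k : ℕ) (a : Fin (k + 1) → M) (ψ : 𝓛.Formula (Fin (k + 1) ⊕ α)), ∀ y : α → M,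
      ψ.Realize (Sum.elim a y) ↔ φ.Realize (Sum.elim id y) := by
  classical
  obtain ⟨m₀⟩ := ‹Nonempty M›
  let T : Finset M := insert m₀ (φ.freeVarFinset.image (Sum.elim id fun _ => m₀))
  obtain ⟨k, hk⟩ : ∃ k, T.card = k + 1 :=
    Nat.exists_eq_succ_of_ne_zero (Finset.card_pos.2 ⟨m₀, Finset.mem_insert_self _ _⟩).ne'
  let e : T ≃ Fin (k + 1) := T.equivFinOfCardEq hk
  let g : M ⊕ α → Fin (k + 1) ⊕ α := Sum.map (fun m => if h : m ∈ T then e ⟨m, h⟩ else 0) id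
  refine ⟨k, fun i => e.symm i, φ.restrictFreeVar fun x => g x, fun y => ?_⟩
  refine BoundedFormula.realize_restrictFreeVar _ fun x => ?_
  obtain ⟨x, hx⟩ := x
  rcases x with m | i
  · have hm : m ∈ T := Finset.mem_insert_of_mem (Finset.mem_image_of_mem _ hx)
    simp [g, hm]
  · rfl

variable (v K) in
/-- The trace on the subfield `K` of every quantifier free definable set is quantifier free
definable. -/
def TraceDefinable : Prop :=
  ∀ (m : ℕ) (E : Set (Fin m → L)), QF v E →
    QF (restrictVal v K) {b : Fin m → K | (fun i => (b i : L)) ∈ E}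

theorem TraceDefinable.trace [Finite α] (h : TraceDefinable v K) {E : Set (α → L)} (hE : QF v E) :
    QF (restrictVal v K) {b : α → K | (fun i => (b i : L)) ∈ E} := by
  obtain ⟨m, ⟨e⟩⟩ := Finite.exists_equiv_fin α
  have h1 := (h m _ (hE.reindex e)).reindex e.symm
  convert h1 using 1
  ext b
  simp only [Set.mem_ofPred_eq]
  refine iff_of_eq (congrArg (· ∈ E) ?_)
  funext i
  simp

/-- The parameters from `L` form a tuple whose type over `K` is definable. The defining formula over
`K` is then made quantifier free by elimination in `K`. -/
theorem traceDefinable_of_fieldTypesDefinable [IsAlgClosed K]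
    (hv : ∃ t : K, t ≠ 0 ∧ restrictVal v K t ≠ 0)
    (h : ∀ n : ℕ, 1 ≤ n → FieldTypesDefinable v K n) : TraceDefinable v K := by
  intro m E hE
  let := valuedFieldStructure (restrictVal v K)
  let := valuedFieldStructure v
  obtain ⟨φ, hφ⟩ := hE.exists_formula
  obtain ⟨k, a, ψ, hψ⟩ := exists_finite_parameters φ
  obtain ⟨δ, hδ⟩ := h (k + 1) (Nat.le_add_left _ _) a m ψ
  convert QF.of_formula_withConstants hv δ using 1
  ext b
  simp only [Set.mem_ofPred_eq]
  rw [← hδ, ← hφ, ← hψ]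
  change _ ↔ (ψ.relabel (Sum.map id b)).Realize (Sum.elim a Subtype.val)
  rw [Formula.realize_relabel]
  refine iff_of_eq (congrArg _ ?_)
  funext i
  cases i <;> rfl

theorem TraceDefinable.fieldTypesDefinable [IsAlgClosed L] (hv : ∃ t : L, t ≠ 0 ∧ v t ≠ 0)
    (h : TraceDefinable v K) (n : ℕ) : FieldTypesDefinable v K n := by
  let := valuedFieldStructure (restrictVal v K)
  let := valuedFieldStructure v
  intro a m φ
  obtain ⟨ψ, hψ⟩ := (h m _ ((QF.of_formula hv φ).specialize a)).exists_formula
  obtain ⟨δ, hδ⟩ := exists_formula_withConstants ψ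
  refine ⟨δ, fun b => ?_⟩
  rw [hδ, hψ]
  change (φ.relabel (Sum.map id b)).Realize (Sum.elim a Subtype.val) ↔ _
  rw [Formula.realize_relabel]
  simp only [Set.mem_ofPred_eq]
  refine iff_of_eq (congrArg _ ?_)
  funext i
  cases i <;> rfl

theorem QF.of_orderedGroup_formula_withConstants {F : Type*} [Field F]
    {v : AddValuation F (WithTop Γ)} [IsAlgClosed F] (hv : ∃ t : F, t ≠ 0 ∧ v t ≠ 0)
    (δ : orderedGroupLang[[valueGroup v]].Formula α) :
    ∃ E : Set (α → F), QF v E ∧ ∀ z : α → F, (∀ i, z i ≠ 0) →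
      (z ∈ E ↔ δ.Realize fun i => valG v (z i)) := by
  obtain ⟨φ, hφ⟩ := exists_formula_of_withConstants δ
  obtain ⟨E, hE, h⟩ := QF.of_orderedGroup_formula hv φ
  choose x hx0 hx using exists_valG_eq (v := v)
  refine ⟨_, hE.specialize x, fun z hz => ?_⟩
  rw [hφ, Set.mem_ofPred_eq, h]
  · refine iff_of_eq (congrArg _ ?_)
    funext i
    cases i
    · exact hx _
    · rfl
  · intro i
    cases i
    · exact hx0 _
    · exact hz _

/-- Definability of the cut of an element of `vL` over `vK`. -/
theorem qf_le_value [IsAlgClosed K] (hv : ∃ t : K, t ≠ 0 ∧ restrictVal v K t ≠ 0)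
    (hT : ValueGroupTypesDefinable v K 1) {l : L} (hl : l ≠ 0) :
    ∃ E : Set (Fin 1 → K), QF (restrictVal v K) E ∧
      ∀ c : Fin 1 → K, c 0 ≠ 0 → (c ∈ E ↔ v (c 0 : L) ≤ v l) := by
  obtain ⟨δ, hδ⟩ := hT (fun _ => valG v l) 1
    (groupLe.formula₂ (Term.var (Sum.inr 0)) (Term.var (Sum.inl 0)))
  obtain ⟨E, hE, h⟩ := QF.of_orderedGroup_formula_withConstants hv δ
  refine ⟨E, hE, fun c hc => ?_⟩
  have hc' : ∀ i, c i ≠ 0 := fun i => by rwa [Subsingleton.elim i 0]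
  rw [h c hc', ← hδ]
  have hc0 : (c 0 : L) ≠ 0 := by simpa using hc
  change (Formula.relabel (Sum.map id _) _).Realize _ ↔ _
  rw [Formula.realize_relabel, Formula.realize_rel₂, ← coe_valG hl]
  have h1 : v (c 0 : L) = ((valG (restrictVal v K) (c 0) : Γ) : WithTop Γ) := (coe_valG (v := restrictVal v K) hc).symm
  rw [h1, WithTop.coe_le_coe]
  rfl

/-- For nonzero `p(b)` and `q(b)` the inequality says that `p(b) / q(b)` has value at most that of
`z / y`. The quotient is introduced as the solution `c` of `c * q(b) = p(b)` and removed by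
projection. -/
theorem qf_scaled_le [IsAlgClosed K] (hv : ∃ t : K, t ≠ 0 ∧ restrictVal v K t ≠ 0)
    (hT : ValueGroupTypesDefinable v K 1) (p q : MvPolynomial α K) {y z : L} (hy : y ≠ 0)
    (hz : z ≠ 0) :
    QF (restrictVal v K) {b : α → K | v ((MvPolynomial.eval b p : L) * y) ≤
      v ((MvPolynomial.eval b q : L) * z)} := by
  obtain ⟨E, hE, h⟩ := qf_le_value hv hT (div_ne_zero hz hy)
  let X₀ : MvPolynomial (Option α) K := MvPolynomial.X none
  have h1 := QF.projection hv ((QF.eq_zero (v := restrictVal v K)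
    (X₀ * MvPolynomial.rename some q - MvPolynomial.rename some p)).inter
      (hE.preimage fun _ => X₀))
  have h2 := (QF.eq_zero (v := restrictVal v K) q).union
    (((QF.eq_zero p).union (QF.eq_zero q)).compl.inter h1)
  convert h2 using 1
  ext b
  simp only [Set.mem_ofPred_eq, Set.mem_union, Set.mem_inter_iff, Set.mem_compl_iff, map_sub,
    map_mul, X₀, MvPolynomial.eval_X, Option.elim_none, MvPolynomial.eval_rename,
    Function.comp_def, Option.elim_some]
  set s : K := MvPolynomial.eval b p
  set t : K := MvPolynomial.eval b q
  change _ ↔ t = 0 ∨ ¬(s = 0 ∨ t = 0) ∧ ∃ c, c * t - s = 0 ∧ (fun _ => c) ∈ E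
  by_cases ht : t = 0
  · simp [ht]
  have htL : (t : L) ≠ 0 := by simpa using ht
  by_cases hs : s = 0
  · simp only [hs, ht, or_false, not_true_eq_false, false_and, iff_false, ZeroMemClass.coe_zero,
      zero_mul, v.map_zero, top_le_iff, v.top_iff]
    exact mul_ne_zero htL hz
  have hsL : (s : L) ≠ 0 := by simpa using hs
  have hst : s / t ≠ 0 := div_ne_zero hs ht
  have hex : (∃ c, c * t - s = 0 ∧ (fun _ => c) ∈ E) ↔ (fun _ => s / t) ∈ E := by
    constructor
    · rintro ⟨c, hc, hcE⟩
      rwa [← sub_eq_zero.1 hc, mul_div_cancel_right₀ _ ht]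
    · intro hE
      exact ⟨s / t, by rw [div_mul_cancel₀ _ ht, sub_self], hE⟩
  rw [hex, h _ hst]
  simp only [ht, hs, or_self, not_false_eq_true, true_and, false_or, Subfield.coe_div]
  have e1 : v ((s : L) * y) = v ((s : L) / t) + v ((t : L) * y) := by
    rw [← v.map_mul]; congr 1; field_simp
  have e2 : v ((t : L) * z) = v (z / y) + v ((t : L) * y) := by
    rw [← v.map_mul]; congr 1; field_simp
  rw [e1, e2]
  have hty : v ((t : L) * y) ≠ ⊤ := (v.ne_top_iff).2 (mul_ne_zero htL hy)
  exact WithTop.add_le_add_iff_right hty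

theorem exists_coordinates {V : Submodule K L} {m : ℕ} (e : Module.Basis (Fin m) K V)
    (P : MvPolynomial α L) (hP : ∀ I, P.coeff I ∈ V) :
    ∃ p : Fin m → MvPolynomial α K, ∀ b : α → K,
      MvPolynomial.eval (fun i => (b i : L)) P =
        ∑ i, ((MvPolynomial.eval b (p i) : K) : L) * (e i : L) := by
  refine ⟨fun i => ∑ I ∈ P.support, MvPolynomial.monomial I (e.repr ⟨P.coeff I, hP I⟩ i),
    fun b => ?_⟩
  have hcoeff : ∀ I, P.coeff I = ∑ i, (e.repr ⟨P.coeff I, hP I⟩ i : L) * (e i : L) := by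
    intro I
    have := congrArg (Subtype.val : V → L) (e.sum_repr ⟨P.coeff I, hP I⟩)
    refine this.symm.trans ?_
    rw [AddSubmonoidClass.coe_finsetSum]
    rfl
  conv_lhs => rw [MvPolynomial.as_sum P]
  simp only [map_sum, MvPolynomial.eval_monomial, AddSubmonoidClass.coe_finsetSum, Subfield.coe_mul,
    Finset.sum_mul]
  rw [Finset.sum_comm]
  refine Finset.sum_congr rfl fun I _ => ?_
  conv_lhs => rw [hcoeff I]
  rw [Finset.sum_mul]
  refine Finset.sum_congr rfl fun i _ => ?_
  have : (((I.prod fun i e => b i ^ e : K)) : L) = I.prod fun i e => (b i : L) ^ e := by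
    simp [Finsupp.prod]
  rw [this]
  ring

/-- In a separated basis of the span of all coefficients, the values of `P` and `Q` are minima over
coordinates. Comparing two minima means that every term of the second is bounded below by some term
of the first. -/
theorem traceDefinable_of_separated [IsAlgClosed K]
    (hv : ∃ t : K, t ≠ 0 ∧ restrictVal v K t ≠ 0) (hsep : IsSeparatedExtension v K)
    (hT : ValueGroupTypesDefinable v K 1) : TraceDefinable v K := by
  classical
  intro m E hE
  induction hE with
  | basic P Q =>
    let V : Submodule K L := Submodule.span K
      ((P.support.image P.coeff ∪ Q.support.image Q.coeff : Finset L) : Set L)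
    have hPV : ∀ I, P.coeff I ∈ V := fun I => by
      by_cases hI : I ∈ P.support
      · exact Submodule.subset_span (Finset.mem_coe.2
          (Finset.mem_union_left _ (Finset.mem_image_of_mem _ hI)))
      · rw [MvPolynomial.notMem_support_iff.1 hI]
        exact V.zero_mem
    have hQV : ∀ I, Q.coeff I ∈ V := fun I => by
      by_cases hI : I ∈ Q.support
      · exact Submodule.subset_span (Finset.mem_coe.2
          (Finset.mem_union_right _ (Finset.mem_image_of_mem _ hI)))
      · rw [MvPolynomial.notMem_support_iff.1 hI]
        exact V.zero_mem
    obtain ⟨n, e, he⟩ := hsep V ⟨_, rfl⟩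
    obtain ⟨p, hp⟩ := exists_coordinates e P hPV
    obtain ⟨q, hq⟩ := exists_coordinates e Q hQV
    have hy : ∀ i, (e i : L) ≠ 0 := fun i h => e.ne_zero i (Subtype.ext h)
    have h1 := QF.forall_fintype fun j : Fin n => QF.exists_fintype fun i : Fin n =>
      qf_scaled_le hv hT (p i) (q j) (hy i) (hy j)
    convert h1 using 1
    ext b
    simp only [Set.mem_ofPred_eq, hp, hq, he _]
    rw [Finset.le_inf_iff]
    refine ⟨fun H j => ?_, fun H j _ => ?_⟩
    · obtain ⟨i, -, hi⟩ := Finset.exists_mem_eq_inf Finset.univ ⟨j, Finset.mem_univ j⟩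
        fun i => v (((MvPolynomial.eval b (p i) : K) : L) * (e i : L))
      exact ⟨i, hi ▸ H j (Finset.mem_univ j)⟩
    · obtain ⟨i, hi⟩ := H j
      exact (Finset.inf_le (Finset.mem_univ i)).trans hi
  | compl _ ih => exact ih.compl
  | inter _ _ ih ih' => exact ih.inter ih'

/-- Definability of types goes down to the value groups. -/
theorem TraceDefinable.valueGroupTypesDefinable [IsAlgClosed L] [IsAlgClosed K]
    (hv : ∃ t : L, t ≠ 0 ∧ v t ≠ 0) (h : TraceDefinable v K) (n : ℕ) :
    ValueGroupTypesDefinable v K n := by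
  intro γ m φ
  choose a ha0 ha using fun i => exists_valG_eq (γ i)
  obtain ⟨E, hE, hEφ⟩ := QF.of_orderedGroup_formula hv φ
  -- The formula `ψ` is only correct at tuples generic for `S`. This suffices, because each tuple
  -- `b` of values has such a lift and membership in the trace depends only on `b`.
  obtain ⟨S, ψ, hψ⟩ := (h m _ (hE.specialize a)).exists_group_formula
  obtain ⟨δ, hδ⟩ := exists_formula_withConstants ψ
  refine ⟨δ, fun b => ?_⟩
  choose y₀ hy₀ hb using fun i => exists_valG_eq (b i)
  obtain ⟨y, hy, hyv, hyS⟩ := exists_generic_lift (v := restrictVal v K) S hy₀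
  have hyb : ∀ i, valG (restrictVal v K) (y i) = b i := fun i => by
    rw [← hb, valG_eq_valG (hy i) (hy₀ i), hyv]
  have hyL : ∀ i, (y i : L) ≠ 0 := fun i => by simpa using hy i
  have hinc : ∀ i, valG v (y i : L) =
      AddSubgroup.inclusion (valueGroup_restrictVal_le v K) (b i) := fun i => by
    apply Subtype.ext
    rw [← WithTop.coe_inj, coe_valG (hyL i), AddSubgroup.coe_inclusion, ← hyb,
      coe_valG (hy i)]
    rfl
  have h1 := hψ y hy hyS
  rw [funext hyb] at h1
  rw [hδ, h1]
  change (φ.relabel (Sum.map id b)).Realize _ ↔ _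
  rw [Formula.realize_relabel, Set.mem_ofPred_eq, Set.mem_ofPred_eq, hEφ]
  · refine iff_of_eq (congrArg _ ?_)
    funext i
    cases i
    · exact (ha _).symm
    · exact (hinc _).symm
  · intro i
    cases i
    · exact ha0 _
    · exact hyL _

end Trace

end DefinableTypes

/-! ### Definable nests of balls -/

namespace DefinableTypes

section Nest

variable {Γ : Type*} [AddCommGroup Γ] [LinearOrder Γ] [IsOrderedAddMonoid Γ]
  {F : Type*} [Field F] {v : AddValuation F (WithTop Γ)} {α : Type*}

theorem tropEval_congr {P Q : MvPolynomial α F} (h : ∀ I, v (P.coeff I) = v (Q.coeff I))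
    (y : α → F) : tropEval v y P = tropEval v y Q := by
  have hsupp : P.support = Q.support := by
    ext I
    rw [MvPolynomial.mem_support_iff, MvPolynomial.mem_support_iff, ← v.ne_top_iff, h,
      v.ne_top_iff]
  rw [tropEval, tropEval, hsupp]
  refine Finset.inf_congr rfl fun I _ => ?_
  rw [MvPolynomial.eval_monomial, MvPolynomial.eval_monomial, v.map_mul, v.map_mul, h]

theorem QF.exists_fin [IsAlgClosed F] (hv : ∃ t : F, t ≠ 0 ∧ v t ≠ 0) {n : ℕ}
    {E : Set (α ⊕ Fin n → F)} (hE : QF v E) :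
    QF v {y : α → F | ∃ x : Fin n → F, Sum.elim y x ∈ E} := by
  induction n with
  | zero =>
    convert hE.preimage (β := α) (Sum.elim (fun a => MvPolynomial.X a) fun i => i.elim0) using 1
    ext y
    have : ∀ x : Fin 0 → F, (fun a => MvPolynomial.eval y
        (Sum.elim (fun a => MvPolynomial.X a) (fun i => i.elim0) a)) = Sum.elim y x := fun x => by
      funext i
      rcases i with i | i
      · simp
      · exact i.elim0
    simp only [Set.mem_ofPred_eq, this Fin.elim0]
    exact ⟨fun ⟨x, hx⟩ => by rwa [Subsingleton.elim Fin.elim0 x], fun h => ⟨_, h⟩⟩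
  | succ n ih =>
    convert ih (QF.forall_last hv hE.compl).compl using 1
    ext y
    simp only [Set.mem_ofPred_eq, Set.mem_compl_iff, not_forall, not_not, Sum.elim_comp_inl,
      Sum.elim_comp_inr]
    constructor
    · rintro ⟨x, hx⟩
      exact ⟨Fin.init x, x (Fin.last n), by rwa [Fin.snoc_init_self]⟩
    · rintro ⟨x, t, hx⟩
      exact ⟨_, hx⟩

/-- The values of polynomials are eventually constant along a nest of balls without center. -/
theorem exists_eventually_constant [IsAlgClosed F] {d : F → F}
    (h₁ : ∀ c c', v (d c) < v (d c') → v (c - c') = v (d c)) (p : Polynomial F) :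
    ∃ c₀, ∀ c c', v (d c₀) < v (d c) → v (d c₀) < v (d c') → v (p.eval c) = v (p.eval c') := by
  have hp := IsAlgClosed.splits p
  have hprod : ∀ s : Multiset F, ∃ c₀, ∀ c c', v (d c₀) < v (d c) → v (d c₀) < v (d c') →
      v (s.map fun e => c - e).prod = v (s.map fun e => c' - e).prod := by
    intro s
    induction s using Multiset.induction with
    | empty => exact ⟨0, fun _ _ _ _ => rfl⟩
    | cons e s ih =>
      obtain ⟨c₀, h⟩ := ih
      -- A root `e` is left behind by the nest: points further along it are all at the same distance
      -- from `e`.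
      have hconst : ∀ c, v (d e) < v (d c) → v (c - e) = v (d e) := fun c hc => by
        rw [← h₁ e c hc, ← v.map_neg, neg_sub]
      rcases le_total (v (d c₀)) (v (d e)) with hle | hle
      · refine ⟨e, fun c c' hc hc' => ?_⟩
        rw [Multiset.map_cons, Multiset.map_cons, Multiset.prod_cons, Multiset.prod_cons,
          v.map_mul, v.map_mul, h c c' (hle.trans_lt hc) (hle.trans_lt hc'), hconst c hc,
          hconst c' hc']
      · refine ⟨c₀, fun c c' hc hc' => ?_⟩
        rw [Multiset.map_cons, Multiset.map_cons, Multiset.prod_cons, Multiset.prod_cons,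
          v.map_mul, v.map_mul, h c c' hc hc', hconst c (hle.trans_lt hc),
          hconst c' (hle.trans_lt hc')]
  obtain ⟨c₀, h⟩ := hprod p.roots
  refine ⟨c₀, fun c c' hc hc' => ?_⟩
  rw [hp.eval_eq_prod_roots, hp.eval_eq_prod_roots, v.map_mul, v.map_mul, h c c' hc hc']

/-- A definable nest of balls of an algebraically closed valued field has a center. -/
theorem QF.nest_false [IsAlgClosed F] {d : F → F} (hd : ∀ c, d c ≠ 0)
    (h₁ : ∀ c c', v (d c) < v (d c') → v (c - c') = v (d c)) (h₂ : ∀ c, ∃ c', v (d c) < v (d c'))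
    (hQ : QF v {z : Option Unit → F | v (d (z (some ()))) ≤ v (z none)}) : False := by
  classical
  obtain ⟨T, hT⟩ := hQ.exists_finset_pattern
  let A : MvPolynomial (Option Unit) F → ℕ → MvPolynomial Unit F := fun P k =>
    (MvPolynomial.optionEquivLeft F Unit P).coeff k
  let N : MvPolynomial (Option Unit) F → ℕ := fun P =>
    (MvPolynomial.optionEquivLeft F Unit P).natDegree
  let R : F → MvPolynomial (Option Unit) F → MvPolynomial Unit F := fun c P =>
    ∑ k ∈ Finset.range (N P + 1),
      MvPolynomial.monomial (Finsupp.single () k) (MvPolynomial.eval (fun _ => c) (A P k))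
  have hReval : ∀ c P (y : Unit → F), MvPolynomial.eval y (R c P) =
      MvPolynomial.eval (fun o : Option Unit => o.elim (y ()) fun _ => c) P := by
    intro c P y
    rw [eval_elim_eq, Polynomial.eval₂_eq_sum_range]
    simp [R, A, N, MvPolynomial.eval_monomial]
  have hRcoeff : ∀ c P I, (R c P).coeff I = MvPolynomial.eval (fun _ => c) (A P (I ())) := by
    intro c P I
    have hI : ∀ k, (Finsupp.single () k = I) ↔ k = I () := fun k => by
      rw [Finsupp.unique_ext_iff]
      simp
    simp only [R, MvPolynomial.coeff_sum, MvPolynomial.coeff_monomial, hI]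
    rw [Finset.sum_ite_eq']
    split_ifs with hmem
    · rfl
    · rw [Finset.mem_range, not_lt] at hmem
      have : A P (I ()) = 0 := Polynomial.coeff_eq_zero_of_natDegree_lt hmem
      rw [this, map_zero]
  have hconst : ∀ S : Finset (MvPolynomial Unit F), ∃ c₀, ∀ c c', v (d c₀) < v (d c) →
      v (d c₀) < v (d c') → ∀ p ∈ S,
        v (MvPolynomial.eval (fun _ => c) p) = v (MvPolynomial.eval (fun _ => c') p) := by
    intro S
    induction S using Finset.induction with
    | empty => exact ⟨0, by simp⟩
    | insert p S _ ih =>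
      obtain ⟨c₀, h⟩ := ih
      obtain ⟨c₁, h'⟩ := exists_eventually_constant h₁
        (MvPolynomial.aeval (fun _ : Unit => (Polynomial.X : Polynomial F)) p)
      have heval : ∀ c, Polynomial.eval c (MvPolynomial.aeval (fun _ : Unit => Polynomial.X) p) =
          MvPolynomial.eval (fun _ => c) p := by
        intro c
        have := MvPolynomial.map_aeval (fun _ : Unit => (Polynomial.X : Polynomial F))
          (Polynomial.evalRingHom c) p
        rw [Polynomial.coe_evalRingHom] at this
        rw [this, MvPolynomial.coe_eval₂Hom, ← MvPolynomial.eval₂_id]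
        congr 1
        · ext; simp
        · funext; simp
      simp only [heval] at h'
      rcases le_total (v (d c₀)) (v (d c₁)) with hle | hle
      · refine ⟨c₁, fun c c' hc hc' q hq => ?_⟩
        rcases Finset.mem_insert.1 hq with rfl | hq
        · exact h' c c' hc hc'
        · exact h c c' (hle.trans_lt hc) (hle.trans_lt hc') q hq
      · refine ⟨c₀, fun c c' hc hc' q hq => ?_⟩
        rcases Finset.mem_insert.1 hq with rfl | hq
        · exact h' c c' (hle.trans_lt hc) (hle.trans_lt hc')
        · exact h c c' hc hc' q hq
  -- Beyond `c₀`, every coefficient in the variable `none` of every polynomial of `T` has constant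
  -- value.
  obtain ⟨c₀, hc₀⟩ := hconst (T.biUnion fun P => (Finset.range (N P + 1)).image (A P))
  obtain ⟨c₁, hc₁⟩ := h₂ c₀
  obtain ⟨c₂, hc₂⟩ := h₂ c₁
  have hcoeff : ∀ P ∈ T, ∀ I, v ((R c₁ P).coeff I) = v ((R c₂ P).coeff I) := by
    intro P hP I
    rw [hRcoeff, hRcoeff]
    by_cases hI : I () < N P + 1
    · exact hc₀ c₁ c₂ hc₁ (hc₁.trans hc₂) _ (Finset.mem_biUnion.2 ⟨P, hP,
        Finset.mem_image_of_mem _ (Finset.mem_range.2 hI)⟩)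
    · have : A P (I ()) = 0 := Polynomial.coeff_eq_zero_of_natDegree_lt (by
        simp only [N] at hI
        omega)
      simp only [this, map_zero]
  -- A generic `y` with the value of `d c₁` cannot be told apart over `c₁` and over `c₂`, although
  -- this value bounds that of `d c₁` and not that of `d c₂`.
  obtain ⟨y, -, hy, hgen⟩ := exists_generic_lift (v := v) (T.image (R c₁) ∪ T.image (R c₂))
    (y₀ := fun _ : Unit => d c₁) fun _ => hd c₁
  have heq : ∀ P ∈ T,
      v (MvPolynomial.eval (fun o : Option Unit => o.elim (y ()) fun _ => c₁) P) =
        v (MvPolynomial.eval (fun o : Option Unit => o.elim (y ()) fun _ => c₂) P) := by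
    intro P hP
    rw [← hReval, ← hReval,
      hgen _ (Finset.mem_union_left _ (Finset.mem_image_of_mem _ hP)),
      hgen _ (Finset.mem_union_right _ (Finset.mem_image_of_mem _ hP)),
      tropEval_congr (hcoeff P hP)]
  have h := hT (fun o : Option Unit => o.elim (y ()) fun _ => c₁)
    (fun o : Option Unit => o.elim (y ()) fun _ => c₂) fun P hP Q hQ => by
      rw [heq P hP, heq Q hQ]
  simp only [Set.mem_ofPred_eq, Option.elim_some, Option.elim_none, hy] at h
  exact absurd (h.1 le_rfl) (not_le.2 hc₂)

end Nest

/-! ### Best approximations and separated bases -/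

section Separated

variable {Γ : Type*} [AddCommGroup Γ] [LinearOrder Γ] [IsOrderedAddMonoid Γ]
  {L : Type*} [Field L] {v : AddValuation L (WithTop Γ)} {K : Subfield L}

theorem val_lt_of_mul_lt {x y e : L} (h : v (x * e) < v (y * e)) : v x < v y := by
  rw [v.map_mul, v.map_mul] at h
  by_contra hcon
  exact absurd h (not_lt.2 (add_le_add (not_lt.1 hcon) le_rfl))

/-- Best approximations exist in the span of a separated sequence. -/
theorem TraceDefinable.exists_best_approximation [IsAlgClosed K]
    (hv : ∃ t : K, t ≠ 0 ∧ restrictVal v K t ≠ 0) (h : TraceDefinable v K) {m : ℕ} {e : Fin m → L}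
    (he : IsSeparatedSeq v K e) (a : L) :
    ∃ w₀ : Fin m → K, ∀ w : Fin m → K,
      v (a - ∑ i, (w i : L) * e i) ≤ v (a - ∑ i, (w₀ i : L) * e i) := by
  by_contra hcon
  push Not at hcon
  let σ : (Fin m → K) → L := fun w => ∑ i, (w i : L) * e i
  change ∀ w, ∃ w', v (a - σ w) < v (a - σ w') at hcon
  have hσsub : ∀ w w', σ (w - w') = σ w - σ w' := fun w w' => by
    simp only [σ, Pi.sub_apply, Subfield.coe_sub, sub_mul, Finset.sum_sub_distrib]
  have hle : ∀ w i, v (σ w) ≤ v ((w i : L) * e i) := fun w i => by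
    simp only [σ, he w]
    exact Finset.inf_le (Finset.mem_univ i)
  -- a coordinate along which the balls have empty intersection
  obtain ⟨i, hi⟩ : ∃ i, ∀ c : K, ∃ w : Fin m → K,
      v (((c : L) - w i) * e i) < v (a - σ w) := by
    by_contra hno
    push Not at hno
    choose c hc using hno
    obtain ⟨w, hw⟩ := hcon c
    -- If each coordinate had a common point `c i` of its balls, separatedness would make `σ c` a
    -- best approximation of `a`.
    have h1 : v (a - σ w) ≤ v (σ (c - w)) := by
      simp only [σ, he (c - w)]
      refine Finset.le_inf fun i _ => ?_
      simpa only [Pi.sub_apply, Subfield.coe_sub] using hc i w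
    have h2 : a - σ c = (a - σ w) - σ (c - w) := by rw [hσsub]; ring
    refine absurd hw (not_lt.2 ?_)
    rw [h2]
    exact v.map_le_sub le_rfl h1
  choose w hw using hi
  have hdist : ∀ w w' : Fin m → K, min (v (a - σ w)) (v (a - σ w')) ≤
      v (((w i : L) - w' i) * e i) := fun w w' => by
    have h1 := hle (w - w') i
    simp only [Pi.sub_apply, Subfield.coe_sub] at h1
    refine le_trans ?_ h1
    have h2 : σ (w - w') = (a - σ w') - (a - σ w) := by rw [hσsub]; ring
    rw [h2]
    exact v.map_le_sub (min_le_right _ _) (min_le_left _ _)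
  -- A point outside a ball is equally far from all its points, and the center of a later ball is
  -- one of them. So the distance from `c` to the nest does not depend on the ball avoiding `c`.
  have hwd₁ : ∀ (c : K) (w w' : Fin m → K), v (((c : L) - w i) * e i) < v (a - σ w) →
      v (a - σ w) ≤ v (a - σ w') → v ((c : L) - w i) = v ((c : L) - w' i) := by
    intro c w w' h1 h3
    have h4 := hdist w w'
    rw [min_eq_left h3] at h4
    have h5 := val_lt_of_mul_lt (h1.trans_le h4)
    have h6 : (c : L) - w' i = ((c : L) - w i) + (w i - w' i) := by ring
    rw [h6, v.map_add_eq_of_lt_left h5]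
  have hwd : ∀ (c : K) (w w' : Fin m → K), v (((c : L) - w i) * e i) < v (a - σ w) →
      v (((c : L) - w' i) * e i) < v (a - σ w') → v ((c : L) - w i) = v ((c : L) - w' i) := by
    intro c w w' h1 h2
    rcases le_total (v (a - σ w)) (v (a - σ w')) with h3 | h3
    · exact hwd₁ c w w' h1 h3
    · exact (hwd₁ c w' w h2 h3).symm
  let d : K → K := fun c => c - w c i
  have hdval : ∀ c, restrictVal v K (d c) = v ((c : L) - w c i) := fun c => rfl
  have hd0 : ∀ c, d c ≠ 0 := fun c hc => by
    have h1 : (c : L) - w c i = 0 := by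
      have := congrArg (Subtype.val : K → L) hc
      simpa [d] using this
    have h2 := hw c
    rw [h1, zero_mul, v.map_zero] at h2
    exact not_top_lt h2
  have h₁ : ∀ c c', restrictVal v K (d c) < restrictVal v K (d c') →
      restrictVal v K (c - c') = restrictVal v K (d c) := by
    intro c c' hcc
    rw [hdval, hdval] at hcc
    have h1 : v ((c : L) - w c i) < v ((c' : L) - w c i) := by
      by_cases h2 : v (((c' : L) - w c i) * e i) < v (a - σ (w c))
      · rwa [hwd c' (w c) (w c') h2 (hw c')]
      · exact val_lt_of_mul_lt ((hw c).trans_le (not_lt.1 h2))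
    rw [hdval]
    have h3 : restrictVal v K (c - c') = v (((c : L) - w c i) - ((c' : L) - w c i)) := by
      rw [sub_sub_sub_cancel_right]
      rfl
    rw [h3, sub_eq_add_neg, v.map_add_eq_of_lt_left]
    rwa [v.map_neg]
  have h₂ : ∀ c, ∃ c', restrictVal v K (d c) < restrictVal v K (d c') := by
    intro c
    refine ⟨w c i, ?_⟩
    rw [hdval, hdval]
    have h1 := hdist (w c) (w (w c i))
    have h2 := hw (w c i)
    rcases min_le_iff.1 h1 with h3 | h3
    · exact val_lt_of_mul_lt ((hw c).trans_le h3)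
    · exact absurd h2 (not_lt.2 h3)
  refine QF.nest_false hd0 h₁ h₂ ?_
  -- The distance from `c` to the nest is defined by quantifying over any `w` whose ball avoids `c`.
  -- This condition has parameters in `L`: its trace on `K` is taken first, and `w` is then
  -- eliminated in `K`.
  let X₁ : MvPolynomial (Option Unit ⊕ Fin m) L :=
    MvPolynomial.X (Sum.inl (some ())) - MvPolynomial.X (Sum.inr i)
  have hE := (QF.basic (v := v) (MvPolynomial.C a -
      ∑ j, MvPolynomial.X (Sum.inr j) * MvPolynomial.C (e j)) (X₁ * MvPolynomial.C (e i))).compl.inter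
    (QF.basic X₁ (MvPolynomial.X (Sum.inl none)))
  convert QF.exists_fin hv (h.trace hE) using 1
  ext z
  simp only [Set.mem_ofPred_eq, Set.mem_inter_iff, Set.mem_compl_iff, X₁, map_sub, map_mul, map_sum,
    MvPolynomial.eval_X, MvPolynomial.eval_C, Sum.elim_inl, Sum.elim_inr, not_le]
  constructor
  · intro hz
    exact ⟨w (z (some ())), hw _, hz⟩
  · rintro ⟨w', hw', hz⟩
    rw [hdval, hwd _ _ w' (hw _) hw']
    exact hz

/-- After scaling, the hypothesis bounds the value of `s + k a` by that of `k a`. It is then also at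
most the value of the difference `s`, to which separatedness of `e` applies. -/
theorem IsSeparatedSeq.snoc {m : ℕ} {e : Fin m → L} (he : IsSeparatedSeq v K e) {a : L}
    (ha : ∀ w : Fin m → K, v (a - ∑ i, (w i : L) * e i) ≤ v a) :
    IsSeparatedSeq v K (Fin.snoc (α := fun _ => L) e a) := by
  intro k
  refine le_antisymm ?_ (v.map_le_sum fun i hi => Finset.inf_le hi)
  rw [Fin.sum_univ_castSucc]
  simp only [Fin.snoc_castSucc, Fin.snoc_last]
  set s : L := ∑ i : Fin m, (k i.castSucc : L) * e i with hs
  have hlast : v (s + (k (Fin.last m) : L) * a) ≤ v ((k (Fin.last m) : L) * a) := by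
    by_cases hk : k (Fin.last m) = 0
    · simp [hk]
    have hkL : (k (Fin.last m) : L) ≠ 0 := by simpa using hk
    have h1 : s + (k (Fin.last m) : L) * a =
        k (Fin.last m) * (a - ∑ i, ((-(k i.castSucc / k (Fin.last m)) : K) : L) * e i) := by
      rw [hs, mul_sub, Finset.mul_sum, add_comm, sub_eq_add_neg, ← Finset.sum_neg_distrib]
      congr 1
      refine Finset.sum_congr rfl fun i _ => ?_
      simp only [Subfield.coe_neg, Subfield.coe_div]
      field_simp
    rw [h1, v.map_mul, v.map_mul]
    exact add_le_add le_rfl (ha _)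
  refine Finset.le_inf fun i _ => ?_
  refine Fin.lastCases ?_ (fun i => ?_) i
  · simpa using hlast
  · simp only [Fin.snoc_castSucc]
    have h1 : v (s + (k (Fin.last m) : L) * a) ≤ v s := by
      have h2 : s = (s + (k (Fin.last m) : L) * a) - (k (Fin.last m) : L) * a := by ring
      conv_rhs => rw [h2]
      exact v.map_le_sub le_rfl hlast
    refine h1.trans ?_
    rw [hs, he fun i => k i.castSucc]
    exact Finset.inf_le (Finset.mem_univ i)

theorem IsSeparatedSeq.linearIndependent {m : ℕ} {e : Fin m → L} (he : IsSeparatedSeq v K e)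
    (h0 : ∀ i, e i ≠ 0) : LinearIndependent K e := by
  rw [Fintype.linearIndependent_iff]
  intro k hk i
  have h1 : ∑ i, (k i : L) * e i = 0 := hk
  have h2 := he k
  rw [h1, v.map_zero] at h2
  have h3 : v ((k i : L) * e i) = ⊤ := top_le_iff.1 (h2.le.trans (Finset.inf_le (Finset.mem_univ i)))
  rw [v.top_iff, mul_eq_zero] at h3
  simpa using h3.resolve_right (h0 i)

/-- Gram-Schmidt: a new generator minus its best approximation can no longer be improved, so it
extends the separated sequence without changing the span. -/
theorem TraceDefinable.isSeparatedExtension [IsAlgClosed K]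
    (hv : ∃ t : K, t ≠ 0 ∧ restrictVal v K t ≠ 0) (h : TraceDefinable v K) :
    IsSeparatedExtension v K := by
  classical
  have key : ∀ s : Finset L, ∃ (m : ℕ) (e : Fin m → L), (∀ i, e i ≠ 0) ∧ IsSeparatedSeq v K e ∧
      Submodule.span K (Set.range e) = Submodule.span K (s : Set L) := by
    intro s
    induction s using Finset.induction with
    | empty =>
      refine ⟨0, Fin.elim0, fun i => i.elim0, fun k => by simp, ?_⟩
      simp
    | insert a s _ ih =>
      obtain ⟨m, e, he0, he, hspan⟩ := ih
      rw [Finset.coe_insert, Submodule.span_insert, ← hspan]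
      by_cases ha : a ∈ Submodule.span K (Set.range e)
      · refine ⟨m, e, he0, he, ?_⟩
        rw [eq_comm, sup_eq_right, Submodule.span_singleton_le_iff_mem]
        exact ha
      obtain ⟨w₀, hw₀⟩ := h.exists_best_approximation hv he a
      have hmem : ∀ w : Fin m → K, ∑ i, (w i : L) * e i ∈ Submodule.span K (Set.range e) :=
        fun w => Submodule.sum_mem _ fun i _ =>
          Submodule.smul_mem _ (w i) (Submodule.subset_span ⟨i, rfl⟩)
      set a' : L := a - ∑ i, (w₀ i : L) * e i with ha'
      refine ⟨m + 1, Fin.snoc (α := fun _ => L) e a', fun i => ?_, he.snoc fun w => ?_, ?_⟩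
      · refine Fin.lastCases ?_ (fun i => ?_) i
        · rw [Fin.snoc_last, ha', sub_ne_zero]
          exact fun h => ha (h ▸ hmem w₀)
        · rw [Fin.snoc_castSucc]
          exact he0 i
      · have h1 := hw₀ (w₀ + w)
        simp only [Pi.add_apply, Subfield.coe_add, add_mul, Finset.sum_add_distrib] at h1
        rwa [← sub_sub] at h1
      · rw [Fin.range_snoc, Submodule.span_insert]
        refine le_antisymm (sup_le ?_ le_sup_right) (sup_le ?_ le_sup_right)
        · rw [Submodule.span_singleton_le_iff_mem]
          exact Submodule.sub_mem _ (Submodule.mem_sup_left (Submodule.mem_span_singleton_self a))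
            (Submodule.mem_sup_right (hmem w₀))
        · rw [Submodule.span_singleton_le_iff_mem]
          have h1 : a = a' + ∑ i, (w₀ i : L) * e i := by rw [ha']; ring
          rw [h1]
          exact Submodule.add_mem _
            (Submodule.mem_sup_left (Submodule.mem_span_singleton_self a'))
            (Submodule.mem_sup_right (hmem w₀))
  rintro V ⟨s, rfl⟩
  obtain ⟨m, e, he0, he, hspan⟩ := key s
  rw [← hspan]
  refine ⟨m, Module.Basis.span (he.linearIndependent he0), ?_⟩
  have : (fun i => ((Module.Basis.span (he.linearIndependent he0)) i : L)) = e :=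
    funext fun i => congrArg Subtype.val (Module.Basis.span_apply _ i)
  rw [this]
  exact he

end Separated

end DefinableTypes

theorem theorem1p7 {Γ : Type*} [AddCommGroup Γ] [LinearOrder Γ] [IsOrderedAddMonoid Γ]
    {L : Type*} [Field L] (v : AddValuation L (WithTop Γ)) (K : Subfield L)
    (hK : DefinableTypes.IsModelACVF (DefinableTypes.restrictVal v K))
    (hL : DefinableTypes.IsModelACVF v)
    (hKL : DefinableTypes.IsElementaryExtension v K) :
    (∀ n : ℕ, 1 ≤ n → DefinableTypes.FieldTypesDefinable v K n) ↔
      (DefinableTypes.IsSeparatedExtension v K ∧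
        DefinableTypes.ValueGroupTypesDefinable v K 1) := by
  have := hK.isAlgClosed
  have := hL.isAlgClosed
  constructor
  · intro h
    have ht := DefinableTypes.traceDefinable_of_fieldTypesDefinable hK.nontrivial h
    exact ⟨ht.isSeparatedExtension hK.nontrivial,
      ht.valueGroupTypesDefinable hL.nontrivial 1⟩
  · rintro ⟨hsep, hT⟩ n -
    exact (DefinableTypes.traceDefinable_of_separated hK.nontrivial hsep hT).fieldTypesDefinable
      hL.nontrivial n
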